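/- **Theorem 2 (Performance guarantees of DADS-BS).** Let $\omega_{\rm b},C_{\rm f},L_{\rm f},R_{\rm f},L,R>0$, let $K_{\rm VC},K_{\rm CC},\mu_{\rm d},\mu_{\rm q},\Gamma_{\rm d},\Gamma_{\rm q},\varepsilon,\omega_{\rm pc},\omega_{\rm qc},\overline Q>0$, $\overline P\in(0,+\infty]$, $\xi_{\rm p},\xi_{\rm q}>1$, and $\omega_0,V_0,P_0,Q_0,K_{\rm P},K_{\rm Q}\in\mathbb R$. For $\overline x\in(0,+\infty]$ let $\operatorname{sat}_{\overline x}(y)$ be $\overline x$ if $y>\overline x$, $-\overline x$ if $y<-\overline x$, and $y$ otherwise. Put $$p=v_{\rm cd}i_{\rm gd}+v_{\rm cq}i_{\rm gq},\quad q=v_{\rm cq}i_{\rm gd}-v_{\rm cd}i_{\rm gq},\quad v_{\rm cd}^{\rm r}=V_0+K_{\rm Q}(Q_0-q_1),\quad \omega=\omega_0+K_{\rm P}(P_0-p_1),$$ $$i_{\rm td}^{\rm r}=i_{\rm gd}-C_{\rm f}\omega v_{\rm cq}-\tfrac{C_{\rm f}K_{\rm Q}}{\omega_{\rm b}}q_2-\tfrac{C_{\rm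 f}K_{\rm VC}}{\omega_{\rm b}}(v_{\rm cd}-v_{\rm cd}^{\rm r}),\qquad i_{\rm tq}^{\rm r}=i_{\rm gq}+C_{\rm f}\omega v_{\rm cd}-\tfrac{C_{\rm f}K_{\rm VC}}{\omega_{\rm b}}v_{\rm cq},$$ $$W_{\rm d}=\tfrac12(v_{\rm cd}-v_{\rm cd}^{\rm r})^2+\tfrac12(i_{\rm td}-i_{\rm td}^{\rm r})^2,\qquad W_{\rm q}=\tfrac12v_{\rm cq}^2+\tfrac12(i_{\rm tq}-i_{\rm tq}^{\rm r})^2,$$ $$u_{\rm d}=-\Big(K_{\rm CC}+\tfrac{(1+e^{z_{\rm d}})\omega_{\rm b}^2}{4\mu_{\rm d}}(1+i_{\rm gd}^2+v_{\rm cd}^2)\Big)(i_{\rm td}-i_{\rm td}^{\rm r})-\tfrac{\omega_{\rm b}}{C_{\rm f}}(v_{\rm cd}-v_{\rm cd}^{\rm r}),$$ $$u_{\rm q}=-\Big(K_{\rm CC}+\tfrac{(1+e^{z_{\rm q}})\omega_{\rm b}^2}{4\mu_{\rm q}}(1+i_{\rm gq}^2+v_{\rm cq}^2)\Big)(i_{\rm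 tq}-i_{\rm tq}^{\rm r})-\tfrac{\omega_{\rm b}}{C_{\rm f}}v_{\rm cq},$$ and let the DADS-BS terminal voltages be $$\begin{aligned}v_{\rm td}=\tfrac{L_{\rm f}}{\omega_{\rm b}}\Big[&-2\omega_{\rm b}\omega(i_{\rm tq}-i_{\rm gq})+\tfrac{\omega_{\rm b}R_{\rm f}}{L_{\rm f}}i_{\rm td}+\omega_{\rm b}\big(\tfrac1{L_{\rm f}}+\omega^2C_{\rm f}\big)v_{\rm cd}+C_{\rm f}K_{\rm P}p_2v_{\rm cq}-K_{\rm VC}(i_{\rm td}-i_{\rm td}^{\rm r})\\&+\tfrac{C_{\rm f}K_{\rm VC}^2}{\omega_{\rm b}}(v_{\rm cd}-v_{\rm cd}^{\rm r})+\tfrac{2\xi_{\rm q}\omega_{\rm qc}K_{\rm Q}C_{\rm f}}{\omega_{\rm b}}q_2+\tfrac{\omega_{\rm qc}^2K_{\rm Q}C_{\rm f}}{\omega_{\rm b}}\big(q_1-\operatorname{sat}_{\overline Q}(q)\big)+u_{\rm d}\Big],\end{aligned}$$ $$\begin{aligned}v_{\rm tq}=\tfrac{L_{\rm f}}{\omega_{\rm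 b}}\Big[&2\omega_{\rm b}\omega(i_{\rm td}-i_{\rm gd})+\tfrac{\omega_{\rm b}R_{\rm f}}{L_{\rm f}}i_{\rm tq}+\omega_{\rm b}\big(\tfrac1{L_{\rm f}}+C_{\rm f}\omega^2+\tfrac{C_{\rm f}K_{\rm VC}^2}{\omega_{\rm b}^2}\big)v_{\rm cq}-C_{\rm f}K_{\rm P}p_2v_{\rm cd}\\&-K_{\rm VC}(i_{\rm tq}-i_{\rm tq}^{\rm r})+u_{\rm q}\Big].\end{aligned}$$ For grid voltages $v_{\rm gd},v_{\rm gq}\in L^\infty(\mathbb R_+;\mathbb R)$ consider the closed loop $$\begin{aligned} \dot v_{\rm cd}&=\omega_{\rm b}\omega v_{\rm cq}+\tfrac{\omega_{\rm b}}{C_{\rm f}}(i_{\rm td}-i_{\rm gd}),&\dot v_{\rm cq}&=-\omega_{\rm b}\omega v_{\rm cd}+\tfrac{\omega_{\rm b}}{C_{\rm f}}(i_{\rm tq}-i_{\rm gq}),\\ \dot i_{\rm td}&=\omega_{\rm b}\omega i_{\rm tq}+\tfrac{\omega_{\rm b}}{L_{\rm f}}(v_{\rm td}-v_{\rm cd})-\tfrac{\omega_{\rm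 b}R_{\rm f}}{L_{\rm f}}i_{\rm td},&\dot i_{\rm tq}&=-\omega_{\rm b}\omega i_{\rm td}+\tfrac{\omega_{\rm b}}{L_{\rm f}}(v_{\rm tq}-v_{\rm cq})-\tfrac{\omega_{\rm b}R_{\rm f}}{L_{\rm f}}i_{\rm tq},\\ \dot i_{\rm gd}&=\omega_{\rm b}\omega i_{\rm gq}+\tfrac{\omega_{\rm b}}{L}(v_{\rm cd}-v_{\rm gd})-\tfrac{\omega_{\rm b}R}{L}i_{\rm gd},&\dot i_{\rm gq}&=-\omega_{\rm b}\omega i_{\rm gd}+\tfrac{\omega_{\rm b}}{L}(v_{\rm cq}-v_{\rm gq})-\tfrac{\omega_{\rm b}R}{L}i_{\rm gq},\\ \dot q_1&=q_2,&\dot q_2&=-2\xi_{\rm q}\omega_{\rm qc}q_2-\omega_{\rm qc}^2\big(q_1-\operatorname{sat}_{\overline Q}(q)\big),\\ \dot p_1&=p_2,&\dot p_2&=-2\xi_{\rm p}\omega_{\rm pc}p_2-\omega_{\rm pc}^2\big(p_1-\operatorname{sat}_{\overline P}(p)\big),\\ \dot z_{\rm d}&=\Gamma_{\rm d}e^{-z_{\rm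 d}}\max\{W_{\rm d}-\varepsilon,0\},&\dot z_{\rm q}&=\Gamma_{\rm q}e^{-z_{\rm q}}\max\{W_{\rm q}-\varepsilon,0\}. \end{aligned}$$ Then for every initial condition in $\mathbb R^{10}\times\mathbb R\times\mathbb R$ the closed loop has a unique (locally) absolutely continuous solution on $[0,\infty)$, the equations being satisfied for almost every $t\ge0$. With $k=\min\{K_{\rm VC},K_{\rm CC}\}$ and $\|\cdot\|_\infty$ the essential supremum norm on $[0,\infty)$, it satisfies, for all $t\ge0$, $$\big(v_{\rm cd}(t)-v_{\rm cd}^{\rm r}(t)\big)^2\le 2W_{\rm d}(t)\le 2e^{-2kt}W_{\rm d}(0)+\frac{\mu_{\rm d}\big(1+R^2+\|v_{\rm gd}\|_\infty^2\big)}{kL^2},$$ $$v_{\rm cq}(t)^2\le 2W_{\rm q}(t)\le 2e^{-2kt}W_{\rm q}(0)+\frac{\mu_{\rm q}\big(1+R^2+\|v_{\rm gq}\|_\infty^2\big)}{kL^2}.$$ Moreover, $$\limsup_{t\to+\infty}|v_{\rm cd}(t)-v_{\rm cd}^{\rm r}(t)|\le\sqrt{2\varepsilon},\qquad \limsup_{t\to+\infty}|v_{\rm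 cq}(t)|\le\sqrt{2\varepsilon}.$$ -/

import Mathlib

open MeasureTheory Filter

noncomputable section

namespace GFM

/-- Physical parameters on the inverter side of the point of common coupling (PCC):
base angular frequency and the output filter. -/
structure FilterParams where
  ωb : ℝ
  Cf : ℝ
  Lf : ℝ
  Rf : ℝ

/-- External network parameters: line inductance and resistance. The control laws below do not
have access to them. -/
structure NetworkParams where
  L : ℝ
  R : ℝ

/-- Controller design parameters, droop coefficients and setpoints. The active-power saturation
level `Pbar` may be `⊤` (no saturation). -/
structure DesignParams where
  KVC : ℝ
  KCC : ℝ
  μd : ℝ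
  μq : ℝ
  Γd : ℝ
  Γq : ℝ
  ε : ℝ
  ωpc : ℝ
  ωqc : ℝ
  ξp : ℝ
  ξq : ℝ
  Qbar : ℝ
  Pbar : EReal
  ω0 : ℝ
  V0 : ℝ
  P0 : ℝ
  Q0 : ℝ
  KP : ℝ
  KQ : ℝ

/-- Names of the closed-loop state variables: PCC voltage, terminal current and grid current in
the local dq frame, reactive- and active-power filter states, and the two adaptive gains. -/
inductive Coord
  | vcd | vcq | itd | itq | igd | igq | q1 | q2 | p1 | p2 | zd | zq
  deriving DecidableEq

instance : Fintype Coord where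
  elems := {.vcd, .vcq, .itd, .itq, .igd, .igq, .q1, .q2, .p1, .p2, .zd, .zq}
  complete c := by cases c <;> decide

/-- The closed-loop state space `ℝ¹⁰ × ℝ × ℝ`. -/
abbrev State := Coord → ℝ

/-- Saturation at a level in `(0, +∞]`. -/
def sat (X : EReal) (y : ℝ) : ℝ :=
  if X < (y : EReal) then X.toReal
  else if (y : EReal) < -X then -X.toReal
  else y

variable (F : FilterParams) (N : NetworkParams) (D : DesignParams) (x : State)

/-- Instantaneous active power at the PCC. -/
def activePower : ℝ := x .vcd * x .igd + x .vcq * x .igq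

/-- Instantaneous reactive power at the PCC. -/
def reactivePower : ℝ := x .vcq * x .igd - x .vcd * x .igq

/-- Droop-generated d-axis voltage reference (the q-axis reference is zero). -/
def vcdRef : ℝ := D.V0 + D.KQ * (D.Q0 - x .q1)

/-- Droop-generated electrical frequency. -/
def freq : ℝ := D.ω0 + D.KP * (D.P0 - x .p1)

/-- d-axis reference terminal current. -/
def itdRef : ℝ :=
  x .igd - F.Cf * freq D x * x .vcq - F.Cf * D.KQ / F.ωb * x .q2
    - F.Cf * D.KVC / F.ωb * (x .vcd - vcdRef D x)

/-- q-axis reference terminal current. -/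
def itqRef : ℝ :=
  x .igq + F.Cf * freq D x * x .vcd - F.Cf * D.KVC / F.ωb * x .vcq

/-- d-channel storage function. -/
def Wd : ℝ := 1 / 2 * (x .vcd - vcdRef D x) ^ 2 + 1 / 2 * (x .itd - itdRef F D x) ^ 2

/-- q-channel storage function. -/
def Wq : ℝ := 1 / 2 * x .vcq ^ 2 + 1 / 2 * (x .itq - itqRef F D x) ^ 2

/-- d-axis nonlinear damping input. -/
def ud : ℝ :=
  -(D.KCC + (1 + Real.exp (x .zd)) * F.ωb ^ 2 / (4 * D.μd) * (1 + x .igd ^ 2 + x .vcd ^ 2))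
      * (x .itd - itdRef F D x)
    - F.ωb / F.Cf * (x .vcd - vcdRef D x)

/-- q-axis nonlinear damping input. -/
def uq : ℝ :=
  -(D.KCC + (1 + Real.exp (x .zq)) * F.ωb ^ 2 / (4 * D.μq) * (1 + x .igq ^ 2 + x .vcq ^ 2))
      * (x .itq - itqRef F D x)
    - F.ωb / F.Cf * x .vcq

/-- d-axis terminal voltage commanded by the DADS-BS controller. -/
def vtd : ℝ :=
  F.Lf / F.ωb *
    (-2 * F.ωb * freq D x * (x .itq - x .igq) + F.ωb * F.Rf / F.Lf * x .itd
      + F.ωb * (1 / F.Lf + freq D x ^ 2 * F.Cf) * x .vcd + F.Cf * D.KP * x .p2 * x .vcq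
      - D.KVC * (x .itd - itdRef F D x)
      + F.Cf * D.KVC ^ 2 / F.ωb * (x .vcd - vcdRef D x)
      + 2 * D.ξq * D.ωqc * D.KQ * F.Cf / F.ωb * x .q2
      + D.ωqc ^ 2 * D.KQ * F.Cf / F.ωb * (x .q1 - sat D.Qbar (reactivePower x))
      + ud F D x)

/-- q-axis terminal voltage commanded by the DADS-BS controller. -/
def vtq : ℝ :=
  F.Lf / F.ωb *
    (2 * F.ωb * freq D x * (x .itd - x .igd) + F.ωb * F.Rf / F.Lf * x .itq
      + F.ωb * (1 / F.Lf + F.Cf * freq D x ^ 2 + F.Cf * D.KVC ^ 2 / F.ωb ^ 2) * x .vcq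
      - F.Cf * D.KP * x .p2 * x .vcd
      - D.KVC * (x .itq - itqRef F D x)
      + uq F D x)

/-- Right-hand side of the closed-loop dynamics when the grid voltage is `(vgd, vgq)`. -/
def closedLoop (vgd vgq : ℝ) : State
  | .vcd => F.ωb * freq D x * x .vcq + F.ωb / F.Cf * (x .itd - x .igd)
  | .vcq => -F.ωb * freq D x * x .vcd + F.ωb / F.Cf * (x .itq - x .igq)
  | .itd => F.ωb * freq D x * x .itq + F.ωb / F.Lf * (vtd F D x - x .vcd)
      - F.ωb * F.Rf / F.Lf * x .itd
  | .itq => -F.ωb * freq D x * x .itd + F.ωb / F.Lf * (vtq F D x - x .vcq)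
      - F.ωb * F.Rf / F.Lf * x .itq
  | .igd => F.ωb * freq D x * x .igq + F.ωb / N.L * (x .vcd - vgd)
      - F.ωb * N.R / N.L * x .igd
  | .igq => -F.ωb * freq D x * x .igd + F.ωb / N.L * (x .vcq - vgq)
      - F.ωb * N.R / N.L * x .igq
  | .q1 => x .q2
  | .q2 => -2 * D.ξq * D.ωqc * x .q2 - D.ωqc ^ 2 * (x .q1 - sat D.Qbar (reactivePower x))
  | .p1 => x .p2
  | .p2 => -2 * D.ξp * D.ωpc * x .p2 - D.ωpc ^ 2 * (x .p1 - sat D.Pbar (activePower x))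
  | .zd => D.Γd * Real.exp (-x .zd) * max (Wd F D x - D.ε) 0
  | .zq => D.Γq * Real.exp (-x .zq) * max (Wq F D x - D.ε) 0

/-- `X` is an absolutely continuous solution on `[0, ∞)` of the closed loop driven by the grid
voltage signals `vgd`, `vgq`, with initial state `x`: it is absolutely continuous on every compact
interval `[0, T]` and satisfies the differential equations for almost every `t ≥ 0`. Values of `X`
at negative times are irrelevant. -/
structure IsSolution (vgd vgq : ℝ → ℝ) (X : ℝ → State) : Prop where
  init : X 0 = x
  absCont : ∀ T : ℝ, 0 ≤ T → AbsolutelyContinuousOnInterval X 0 T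
  ode : ∀ᵐ t ∂(volume.restrict (Set.Ici (0 : ℝ))),
    HasDerivAt X (closedLoop F N D (X t) (vgd t) (vgq t)) t

/-- Membership in `L^∞(ℝ₊; ℝ)`; the function is only looked at on `[0, ∞)`. -/
def MemLinfty (v : ℝ → ℝ) : Prop := MemLp v ⊤ (volume.restrict (Set.Ici (0 : ℝ)))

/-- The essential supremum of `|v|` over `[0, ∞)`. -/
def normLinfty (v : ℝ → ℝ) : ℝ := (eLpNorm v ⊤ (volume.restrict (Set.Ici (0 : ℝ)))).toReal

end GFM

end

/-!
The errors `a = v_cd - v_cd^r` and `b = i_td - i_td^r` (and likewise in the q channel) satisfy the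
backstepping equations `a' = c b - K_VC a` and `b' = -c a - K_CC b - damping + disturbance`,
whose cross terms cancel in the energy `W = (a² + b²) / 2`. Cauchy–Schwarz bounds the squared
disturbance by a multiple of `(1 + i_g² + v_c²) (1 + R² + ‖v_g‖²) / L²`, and Young's inequality
against the damping gives `W' ≤ -2 k W + M / (1 + e^z)` with `M = μ (1 + R² + ‖v_g‖²) / L²`. The
exponential estimate is then Grönwall's inequality. For the limsup, note that `z` is nondecreasing.
If `z` is unbounded, the disturbance dies out and `W` tends to zero. If `z` converges, its
increments vanish; since `W` grows at most at a bounded rate, it cannot exceed `ε + δ` at late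
times, as `z` would then increase by a fixed amount.

Global existence follows from a priori bounds obtained in cascade: the energies, the reactive-power
filter (whose input is saturated), the PCC voltage, the grid currents, the active-power filter, and
finally the terminal currents and the gains.
-/

section AbsolutelyContinuous

open Set Topology

section Lipschitz

variable {X Y : Type*} {a b : ℝ}

theorem absolutelyContinuousOnInterval_of_dist_le [PseudoMetricSpace X] [PseudoMetricSpace Y]
    {f : ℝ → X} {g : ℝ → Y} {K : ℝ}
    (hf : AbsolutelyContinuousOnInterval f a b)
    (hfg : ∀ s ∈ uIcc a b, ∀ t ∈ uIcc a b, dist (g s) (g t) ≤ K * dist (f s) (f t)) :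
    AbsolutelyContinuousOnInterval g a b := by
  rw [absolutelyContinuousOnInterval_iff] at hf ⊢
  intro ε hε
  obtain ⟨δ, hδ, h⟩ := hf (ε / (|K| + 1)) (by positivity)
  refine ⟨δ, hδ, fun I hI hlt => ?_⟩
  calc
    _ ≤ ∑ i ∈ Finset.range I.1, (|K| + 1) * dist (f (I.2 i).1) (f (I.2 i).2) :=
      Finset.sum_le_sum fun i hi => (hfg _ (hI.1 i hi).1 _ (hI.1 i hi).2).trans <|
        mul_le_mul_of_nonneg_right (by linarith [le_abs_self K]) dist_nonneg
    _ = (|K| + 1) * ∑ i ∈ Finset.range I.1, dist (f (I.2 i).1) (f (I.2 i).2) :=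
      (Finset.mul_sum ..).symm
    _ < (|K| + 1) * (ε / (|K| + 1)) := mul_lt_mul_of_pos_left (h I hI hlt) (by positivity)
    _ = ε := by field_simp

theorem absolutelyContinuousOnInterval_comp [SeminormedAddCommGroup X] [PseudoMetricSpace Y]
    {g : X → Y} {f : ℝ → X} (hg : LocallyLipschitz g)
    (hf : AbsolutelyContinuousOnInterval f a b) :
    AbsolutelyContinuousOnInterval (g ∘ f) a b := by
  obtain ⟨K, hK⟩ := hg.locallyLipschitzOn.exists_lipschitzOnWith_of_compact
    (isCompact_uIcc.image_of_continuousOn hf.continuousOn)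
  exact absolutelyContinuousOnInterval_of_dist_le hf fun s hs t ht =>
    hK.dist_le_mul _ (mem_image_of_mem f hs) _ (mem_image_of_mem f ht)

end Lipschitz

section Primitive

variable {E : Type*} [NormedAddCommGroup E] [NormedSpace ℝ E] {f g : ℝ → E} {a b : ℝ}

theorem absolutelyContinuousOnInterval_integral (hf : IntervalIntegrable f volume a b) :
    AbsolutelyContinuousOnInterval (fun t => ∫ s in a..t, f s) a b := by
  have hint : ∀ t ∈ uIcc a b, IntervalIntegrable f volume a t := fun t ht =>
    hf.mono_set (uIcc_subset_uIcc_left ht)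
  refine absolutelyContinuousOnInterval_of_dist_le (K := 1)
    (hf.norm.absolutelyContinuousOnInterval_intervalIntegral left_mem_uIcc) fun s hs t ht => ?_
  rw [dist_eq_norm, Real.dist_eq, one_mul,
    intervalIntegral.integral_interval_sub_left (hint s hs) (hint t ht),
    intervalIntegral.integral_interval_sub_left (hint s hs).norm (hint t ht).norm]
  exact intervalIntegral.norm_integral_le_abs_integral_norm

theorem hasDerivWithinAt_of_ae_hasDerivAt [CompleteSpace E] (hab : a ≤ b)
    (hf : AbsolutelyContinuousOnInterval f a b) (hg : ContinuousOn g (Icc a b))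
    (h : ∀ᵐ t, t ∈ Icc a b → HasDerivAt f (g t) t) {t : ℝ} (ht : t ∈ Icc a b) :
    HasDerivWithinAt f (g t) (Icc a b) t := by
  set G : ℝ → E := IccExtend hab ((Icc a b).domRestrict g)
  have hG : Continuous G := (continuousOn_iff_continuous_domRestrict.1 hg).Icc_extend'
  have hGg : ∀ s ∈ Icc a b, G s = g s := fun s hs => IccExtend_of_mem hab _ hs
  have hI : ∀ s, HasDerivAt (fun u => ∫ r in a..u, G r) (G s) s := fun s =>
    (hG.integral_hasStrictDerivAt a s).hasDerivAt
  obtain ⟨C, hC⟩ := (hf.fun_sub (absolutelyContinuousOnInterval_integral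
    (hG.intervalIntegrable a b))).const_of_ae_hasDerivAt_zero (by
      filter_upwards [h] with s hs hsm
      rw [uIcc_of_le hab] at hsm
      simpa only [hGg s hsm, sub_self] using! (hs hsm).sub (hI s))
  rw [uIcc_of_le hab] at hC
  have hf_eq : ∀ s ∈ Icc a b, f s = (∫ r in a..s, G r) + C := fun s hs => by
    rw [← hC s hs, add_sub_cancel]
  rw [← hGg t ht]
  exact ((hI t).add_const C).hasDerivWithinAt.congr hf_eq (hf_eq t ht)

end Primitive

section Comparison

variable {f : ℝ → ℝ} {a b : ℝ}

theorem le_of_ae_deriv_nonpos (hab : a ≤ b) (hf : AbsolutelyContinuousOnInterval f a b)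
    (hf' : ∀ᵐ t, t ∈ Icc a b → deriv f t ≤ 0) : f b ≤ f a := by
  have h : ∫ t in a..b, deriv f t ≤ ∫ _ in a..b, (0 : ℝ) :=
    intervalIntegral.integral_mono_ae_restrict hab hf.intervalIntegrable_deriv (by simp)
      ((ae_restrict_iff' measurableSet_Icc).2 hf')
  rw [hf.integral_deriv_eq_sub, intervalIntegral.integral_zero] at h
  linarith

theorem le_gronwallBound_of_ae_deriv_le {K m : ℝ} (hab : a ≤ b)
    (hf : AbsolutelyContinuousOnInterval f a b)
    (hf' : ∀ᵐ t, t ∈ Icc a b → deriv f t ≤ K * f t + m) :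
    f b ≤ gronwallBound (f a) K m (b - a) := by
  have hB : AbsolutelyContinuousOnInterval (fun t => gronwallBound (f a) K m (t - a)) a b := by
    refine ContDiffOn.absolutelyContinuousOnInterval (ContDiff.contDiffOn ?_)
    unfold gronwallBound
    split_ifs <;> fun_prop
  have hexp : AbsolutelyContinuousOnInterval (fun t => Real.exp (-K * t)) a b :=
    ContDiffOn.absolutelyContinuousOnInterval (by fun_prop)
  have h := le_of_ae_deriv_nonpos hab (hexp.fun_mul (hf.fun_sub hB)) (by
    filter_upwards [hf', hf.ae_differentiableAt] with t ht htd htm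
    have hft := (htd (Icc_subset_uIcc htm)).hasDerivAt
    refine (((hasDerivAt_id t).const_mul (-K)).exp.mul
      (hft.sub (hasDerivAt_gronwallBound_shift (f a) K m t a))).deriv.trans_le ?_
    have hle := mul_le_mul_of_nonneg_left (ht htm) (Real.exp_pos (-K * t)).le
    simp only [id_eq, Pi.sub_apply]
    linarith)
  simp only [sub_self, gronwallBound_x0, mul_zero] at h
  have := nonpos_of_mul_nonpos_right h (Real.exp_pos _)
  linarith

theorem le_add_mul_of_ae_deriv_le {m : ℝ} (hab : a ≤ b)
    (hf : AbsolutelyContinuousOnInterval f a b) (hf' : ∀ᵐ t, t ∈ Icc a b → deriv f t ≤ m) :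
    f b ≤ f a + m * (b - a) := by
  have h := le_gronwallBound_of_ae_deriv_le (K := 0) (m := m) hab hf (by
    simpa only [zero_mul, zero_add] using hf')
  rwa [gronwallBound_K0] at h

theorem eventually_le_of_ae_deriv_le {c m δ : ℝ} (hc : 0 < c) (hδ : 0 < δ)
    (hf : ∀ b, a ≤ b → AbsolutelyContinuousOnInterval f a b)
    (hf' : ∀ᵐ t, a ≤ t → deriv f t ≤ -c * f t + m) :
    ∀ᶠ t in atTop, f t ≤ m / c + δ := by
  have hexp : Tendsto (fun t => Real.exp (-c * (t - a))) atTop (𝓝 0) :=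
    Real.tendsto_exp_atBot.comp <| (tendsto_atTop_add_const_right _ (-a) tendsto_id
      |>.const_mul_atTop_of_neg (neg_neg_iff_pos.2 hc))
  have hlim : Tendsto (fun t => gronwallBound (f a) (-c) m (t - a)) atTop (𝓝 (m / c)) := by
    rw [gronwallBound_of_K_ne_0 (neg_ne_zero.2 hc.ne')]
    have := (hexp.const_mul (f a)).add ((hexp.sub_const 1).const_mul (m / -c))
    convert this using 2
    field_simp
    ring
  filter_upwards [hlim.eventually_le_const (lt_add_of_pos_right _ hδ), eventually_ge_atTop a]
    with t ht hat
  refine (le_gronwallBound_of_ae_deriv_le hat (hf t hat) ?_).trans ht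
  filter_upwards [hf'] with s hs hsm using hs hsm.1

end Comparison

end AbsolutelyContinuous

section Caratheodory

open Set Topology

variable {E : Type*} [NormedAddCommGroup E] [NormedSpace ℝ E]

/-- A Carathéodory solution on `[0, T]` of the initial value problem `X' = v(t, X)`, `X(0) = x₀`:
an absolutely continuous curve satisfying the equation at almost every time. -/
structure IsCaratheodorySolution (v : ℝ → E → E) (x₀ : E) (T : ℝ) (X : ℝ → E) : Prop where
  init : X 0 = x₀
  absCont : AbsolutelyContinuousOnInterval X 0 T
  ode : ∀ᵐ t, t ∈ Icc 0 T → HasDerivAt X (v t (X t)) t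

namespace IsCaratheodorySolution

section

variable {v : ℝ → E → E} {x₀ : E} {S T : ℝ} {X : ℝ → E}

theorem continuousOn (h : IsCaratheodorySolution v x₀ T X) (hT : 0 ≤ T) :
    ContinuousOn X (Icc 0 T) :=
  uIcc_of_le hT ▸ h.absCont.continuousOn

theorem mono (h : IsCaratheodorySolution v x₀ T X) (hS : S ∈ Icc 0 T) :
    IsCaratheodorySolution v x₀ S X where
  init := h.init
  absCont := h.absCont.mono <|
    uIcc_subset_uIcc_left (uIcc_of_le (hS.1.trans hS.2) ▸ hS)
  ode := by filter_upwards [h.ode] with t ht htm using ht ⟨htm.1, htm.2.trans hS.2⟩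

theorem congr {w : ℝ → E → E} (h : IsCaratheodorySolution v x₀ T X)
    (hvw : ∀ t ∈ Ico 0 T, v t (X t) = w t (X t)) : IsCaratheodorySolution w x₀ T X where
  init := h.init
  absCont := h.absCont
  ode := by
    filter_upwards [h.ode, Measure.ae_ne volume T] with t ht htT htm
    exact hvw t ⟨htm.1, htm.2.lt_of_ne htT⟩ ▸ ht htm

end

section Forced

variable {f : E → E} {d : ℝ → E} {x₀ : E} {T : ℝ} {X Y : ℝ → E}

theorem eqOn [CompleteSpace E] (hf : LocallyLipschitz f) (hT : 0 ≤ T)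
    (hX : IsCaratheodorySolution (fun t x => f x + d t) x₀ T X)
    (hY : IsCaratheodorySolution (fun t x => f x + d t) x₀ T Y) : EqOn X Y (Icc 0 T) := by
  have hXc := hX.continuousOn hT
  have hYc := hY.continuousOn hT
  obtain ⟨K, hK⟩ := hf.locallyLipschitzOn.exists_lipschitzOnWith_of_compact
    ((isCompact_Icc.image_of_continuousOn hXc).union (isCompact_Icc.image_of_continuousOn hYc))
  -- The forcing cancels in the difference, whose derivative is therefore continuous.
  have hderiv : ∀ t ∈ Icc 0 T, HasDerivWithinAt (X - Y) (f (X t) - f (Y t)) (Icc 0 T) t :=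
    fun t => hasDerivWithinAt_of_ae_hasDerivAt hT (hX.absCont.sub hY.absCont)
      ((hf.continuous.comp_continuousOn hXc).sub (hf.continuous.comp_continuousOn hYc)) (by
        filter_upwards [hX.ode, hY.ode] with s hsX hsY hs
        simpa only [add_sub_add_right_eq_sub] using! (hsX hs).sub (hsY hs))
  have hzero := eq_zero_of_abs_deriv_le_mul_abs_self_of_eq_zero_right (K := K) (hXc.sub hYc)
    (fun t ht => (hderiv t (Ico_subset_Icc_self ht)).mono_of_mem_nhdsWithin
      (Icc_mem_nhdsGE_of_mem ht))
    (sub_eq_zero.2 (hX.init.trans hY.init.symm))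
    fun t ht => hK.norm_sub_le (.inl (mem_image_of_mem X (Ico_subset_Icc_self ht)))
      (.inr (mem_image_of_mem Y (Ico_subset_Icc_self ht)))
  exact fun t ht => sub_eq_zero.1 (hzero t ht)

theorem exists_of_lipschitzWith [CompleteSpace E] {K C : NNReal} (hf : LipschitzWith K f)
    (hC : ∀ x, ‖f x‖ ≤ C) (hT : 0 ≤ T) (hd : IntervalIntegrable d volume 0 T) (x₀ : E) :
    ∃ X, IsCaratheodorySolution (fun t x => f x + d t) x₀ T X := by
  set G : ℝ → E := fun t => ∫ s in (0 : ℝ)..t, d s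
  have hG : AbsolutelyContinuousOnInterval G 0 T := absolutelyContinuousOnInterval_integral hd
  have hGc : ContinuousOn G (Icc 0 T) := uIcc_of_le hT ▸ hG.continuousOn
  -- `y = X - G` solves the equation `y' = f (y + G)`, whose right-hand side is continuous.
  have hP : IsPicardLindelof (fun t y => f (y + G t)) (tmin := 0) (tmax := T) ⟨0, le_rfl, hT⟩ x₀
      (C * ⟨T, hT⟩) 0 C K := by
    refine ⟨fun t _ y _ z _ => ?_, fun y _ => ?_, fun t _ y _ => hC _, ?_⟩
    · simpa only [edist_add_right] using hf (y + G t) (z + G t)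
    · exact hf.continuous.comp_continuousOn (continuousOn_const.add hGc)
    · simp only [sub_zero, sub_self, hT, sup_of_le_left, NNReal.coe_zero]
      rfl
  obtain ⟨y, hy0, hy⟩ := hP.exists_eq_forall_mem_Icc_hasDerivWithinAt₀
  have hyL : LipschitzOnWith C y (uIcc 0 T) := uIcc_of_le hT ▸
    (convex_Icc 0 T).lipschitzOnWith_of_nnnorm_hasDerivWithin_le hy fun t _ => hC _
  refine ⟨fun t => y t + G t, ?_, hyL.absolutelyContinuousOnInterval.fun_add hG, ?_⟩
  · exact (congrArg₂ _ hy0 intervalIntegral.integral_same).trans (add_zero x₀)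
  · filter_upwards [hd.ae_hasDerivAt_integral, Measure.ae_ne volume 0, Measure.ae_ne volume T]
      with t ht ht0 htT htm
    exact ((hy t htm).hasDerivAt (Icc_mem_nhds (htm.1.lt_of_ne' ht0) (htm.2.lt_of_ne htT))).add
      (ht (Icc_subset_uIcc htm) 0 left_mem_uIcc)

end Forced

end IsCaratheodorySolution

/-- The coordinatewise projection onto the cube `[-M, M]^ι`, used to truncate vector fields. -/
def cubeProj {ι : Type*} (M : ℝ) (x : ι → ℝ) : ι → ℝ := fun i => max (-M) (min M (x i))

section Cube

variable {ι : Type*} [Fintype ι] {M : ℝ}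

theorem lipschitzWith_cubeProj : LipschitzWith 1 (cubeProj (ι := ι) M) := by
  have hclamp : LipschitzWith 1 fun r : ℝ => max (-M) (min M r) :=
    (LipschitzWith.id.const_min M).const_max (-M)
  refine LipschitzWith.of_dist_le_mul fun x y => ?_
  rw [NNReal.coe_one, one_mul, dist_pi_le_iff dist_nonneg]
  exact fun i => (hclamp.dist_le_mul (x i) (y i)).trans <| by
    simpa only [NNReal.coe_one, one_mul] using dist_le_pi_dist x y i

theorem cubeProj_mem_closedBall (hM : 0 ≤ M) (x : ι → ℝ) :
    cubeProj M x ∈ Metric.closedBall 0 M := by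
  rw [mem_closedBall_zero_iff, pi_norm_le_iff_of_nonneg hM]
  exact fun i => abs_le.2 ⟨le_max_left _ _, max_le (by linarith) (min_le_left _ _)⟩

theorem cubeProj_eq_self {x : ι → ℝ} (hx : ‖x‖ ≤ M) : cubeProj M x = x := by
  funext i
  have hi := abs_le.1 ((norm_le_pi_norm x i).trans hx)
  rw [cubeProj, min_eq_right hi.2, max_eq_right hi.1]

end Cube

theorem forall_Icc_lt_of_forall_Ico_lt {g : ℝ → ℝ} {a b M : ℝ} (hg : ContinuousOn g (Icc a b))
    (h : ∀ s ∈ Icc a b, (∀ t ∈ Ico a s, g t < M) → g s < M) : ∀ t ∈ Icc a b, g t < M := by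
  by_contra! hexit
  have hcpt : IsCompact (Icc a b ∩ g ⁻¹' Ici M) :=
    isCompact_Icc.of_isClosed_subset (hg.preimage_isClosed_of_isClosed isClosed_Icc isClosed_Ici)
      inter_subset_left
  obtain ⟨s, ⟨hs, hMs⟩, hmin⟩ := hcpt.exists_isLeast hexit
  refine (h s hs fun t ht => ?_).not_ge hMs
  by_contra! hMt
  exact ht.2.not_ge (hmin ⟨⟨ht.1, ht.2.le.trans hs.2⟩, hMt⟩)

namespace IsCaratheodorySolution

theorem exists_of_apriori_bound {ι : Type*} [Fintype ι] {f : (ι → ℝ) → ι → ℝ} {d : ℝ → ι → ℝ}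
    {x₀ : ι → ℝ} {T B : ℝ} (hT : 0 ≤ T) (hf : LocallyLipschitz f)
    (hd : IntervalIntegrable d volume 0 T)
    (hB : ∀ S ∈ Icc 0 T, ∀ X, IsCaratheodorySolution (fun t x => f x + d t) x₀ S X → ‖X S‖ ≤ B) :
    ∃ X, IsCaratheodorySolution (fun t x => f x + d t) x₀ T X := by
  set M : ℝ := |B| + 1
  have hBM : B < M := by linarith [le_abs_self B]
  have hM0 : 0 ≤ M := by positivity
  obtain ⟨K, hK⟩ := hf.locallyLipschitzOn.exists_lipschitzOnWith_of_compact
    (isCompact_closedBall (0 : ι → ℝ) M)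
  obtain ⟨C, hC⟩ := (isCompact_closedBall (0 : ι → ℝ) M).exists_bound_of_continuousOn
    hf.continuous.continuousOn
  have hLip : LipschitzWith (K * 1) (f ∘ cubeProj M) := lipschitzOnWith_univ.1 <|
    hK.comp lipschitzWith_cubeProj.lipschitzOnWith fun x _ => cubeProj_mem_closedBall hM0 x
  obtain ⟨X, hX⟩ := exists_of_lipschitzWith (C := C.toNNReal) hLip
    (fun x => (hC _ (cubeProj_mem_closedBall hM0 x)).trans (Real.le_coe_toNNReal C)) hT hd x₀
  have huntruncate : ∀ S ∈ Icc 0 T, (∀ t ∈ Ico 0 S, ‖X t‖ < M) →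
      IsCaratheodorySolution (fun t x => f x + d t) x₀ S X := fun S hS hlt =>
    (hX.mono hS).congr fun t ht => by
      simp only [Function.comp_apply, cubeProj_eq_self (hlt t ht).le]
  have hlt : ∀ t ∈ Icc 0 T, ‖X t‖ < M :=
    forall_Icc_lt_of_forall_Ico_lt (hX.continuousOn hT).norm fun S hS hltS =>
      (hB S hS X (huntruncate S hS hltS)).trans_lt hBM
  exact ⟨X, huntruncate T ⟨hT, le_rfl⟩ fun t ht => hlt t (Ico_subset_Icc_self ht)⟩

theorem exists_forall_of_forall_exists [CompleteSpace E] {f : E → E} {d : ℝ → E} {x₀ : E}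
    (hf : LocallyLipschitz f)
    (hex : ∀ T, 0 ≤ T → ∃ X, IsCaratheodorySolution (fun t x => f x + d t) x₀ T X) :
    ∃ X, ∀ T, 0 ≤ T → IsCaratheodorySolution (fun t x => f x + d t) x₀ T X := by
  choose Y hY using fun n : ℕ => hex n n.cast_nonneg
  set X : ℝ → E := fun t => Y ⌈t⌉₊ t
  have hXY : ∀ n : ℕ, EqOn X (Y n) (Icc 0 n) := fun n t ht =>
    eqOn hf (Nat.cast_nonneg _) (hY ⌈t⌉₊)
      ((hY n).mono ⟨Nat.cast_nonneg _, Nat.cast_le.2 (Nat.ceil_le.2 ht.2)⟩) ⟨ht.1, Nat.le_ceil t⟩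
  refine ⟨X, fun T hT => ?_⟩
  obtain ⟨n, hn⟩ := exists_nat_gt T
  have hYT := (hY n).mono ⟨hT, hn.le⟩
  have hXT : ∀ t ∈ uIcc 0 T, X t = Y n t := fun t ht =>
    hXY n (Icc_subset_Icc_right hn.le (uIcc_of_le hT ▸ ht))
  refine ⟨(hXT 0 left_mem_uIcc).trans hYT.init,
    absolutelyContinuousOnInterval_of_dist_le (K := 1) hYT.absCont fun s hs t ht => ?_, ?_⟩
  · rw [hXT s hs, hXT t ht, one_mul]
  · filter_upwards [hYT.ode, Measure.ae_ne volume 0] with t ht ht0 htm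
    rw [hXT t (Icc_subset_uIcc htm)]
    exact (ht htm).congr_of_eventuallyEq <| (hXY n).eventuallyEq_of_mem
      (Icc_mem_nhds (htm.1.lt_of_ne' ht0) (htm.2.trans_lt hn))

end IsCaratheodorySolution

end Caratheodory

section LocallyLipschitz

theorem locallyLipschitz_mul {X : Type*} [PseudoEMetricSpace X] {f g : X → ℝ}
    (hf : LocallyLipschitz f) (hg : LocallyLipschitz g) : LocallyLipschitz fun x => f x * g x :=
  (contDiff_fst.mul contDiff_snd : ContDiff ℝ 1 fun p : ℝ × ℝ => p.1 * p.2).locallyLipschitz.comp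
    (hf.prodMk hg)

theorem locallyLipschitz_pi {X ι : Type*} {Y : ι → Type*} [PseudoEMetricSpace X] [Fintype ι]
    [∀ i, PseudoEMetricSpace (Y i)] {f : X → ∀ i, Y i}
    (hf : ∀ i, LocallyLipschitz fun x => f x i) : LocallyLipschitz f := by
  intro x
  choose K t ht hK using fun i => hf i x
  refine ⟨Finset.univ.sup K, ⋂ i, t i, iInter_mem.2 ht, fun y hy z hz => ?_⟩
  rw [edist_pi_le_iff]
  intro i
  refine (hK i (Set.mem_iInter.1 hy i) (Set.mem_iInter.1 hz i)).trans ?_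
  gcongr
  exact Finset.le_sup (Finset.mem_univ i)

end LocallyLipschitz

section BoundedAtFilter

variable {α E : Type*} [Norm E] {s : Set α}

theorem boundedAtFilter_principal_iff {f : α → E} :
    BoundedAtFilter (𝓟 s) f ↔ ∃ B, ∀ x ∈ s, ‖f x‖ ≤ B := by
  simp only [BoundedAtFilter, Asymptotics.isBigO_principal, Pi.one_apply, norm_one, mul_one]

theorem boundedAtFilter_of_sq_le {l : Filter α} {f V : α → ℝ} {C : ℝ}
    (hV : BoundedAtFilter l V) (hf : ∀ x, f x ^ 2 ≤ C * V x) : BoundedAtFilter l f := by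
  have hsq : (fun x => f x ^ 2) =O[l] V := Asymptotics.IsBigO.of_bound |C| <| .of_forall fun x => by
    rw [Real.norm_eq_abs, Real.norm_eq_abs, abs_of_nonneg (sq_nonneg (f x)), ← abs_mul]
    exact (hf x).trans (le_abs_self _)
  have hone : (fun x => f x ^ 2) =O[l] fun _ => (1 : ℝ) ^ 2 := by
    simpa only [one_pow] using! hsq.trans hV
  exact hone.of_pow two_ne_zero

end BoundedAtFilter

section ReachableSet

open Set

variable {E : Type*} [NormedAddCommGroup E] [NormedSpace ℝ E]

/-- The states occupied up to time `T` by the Carathéodory solutions of `X' = v(t, X)`,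
`X(0) = x₀`. A priori bounds are stated as boundedness of functions on this set. -/
def reachableSet (v : ℝ → E → E) (x₀ : E) (T : ℝ) : Set E :=
  {y | ∃ S ∈ Icc 0 T, ∃ X, IsCaratheodorySolution v x₀ S X ∧ X S = y}

theorem IsCaratheodorySolution.mem_reachableSet {v : ℝ → E → E} {x₀ : E} {S T : ℝ} {X : ℝ → E}
    (h : IsCaratheodorySolution v x₀ S X) (hST : S ≤ T) {t : ℝ} (ht : t ∈ Icc 0 S) :
    X t ∈ reachableSet v x₀ T :=
  ⟨t, ⟨ht.1, ht.2.trans hST⟩, X, h.mono ht, rfl⟩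

theorem boundedAtFilter_reachableSet_of_deriv_le {v : ℝ → E → E} {x₀ : E} {T c m : ℝ} {V : E → ℝ}
    (hV : LocallyLipschitz V) (hV₀ : ∀ x, 0 ≤ V x)
    (hV' : ∀ᵐ t, 0 ≤ t → ∀ X : ℝ → E, X t ∈ reachableSet v x₀ T → HasDerivAt X (v t (X t)) t →
      deriv (fun s => V (X s)) t ≤ c * V (X t) + m) :
    BoundedAtFilter (𝓟 (reachableSet v x₀ T)) V := by
  refine boundedAtFilter_principal_iff.2 ⟨gronwallBound (V x₀) |c| |m| T, ?_⟩
  rintro _ ⟨S, hS, X, hX, rfl⟩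
  rw [Real.norm_of_nonneg (hV₀ _)]
  calc
    V (X S) ≤ gronwallBound (V (X 0)) |c| |m| (S - 0) :=
      le_gronwallBound_of_ae_deriv_le hS.1 (absolutelyContinuousOnInterval_comp hV hX.absCont) (by
        filter_upwards [hV', hX.ode] with t ht hXt htm
        refine (ht htm.1 X (hX.mem_reachableSet hS.2 htm) (hXt htm)).trans ?_
        exact add_le_add (mul_le_mul_of_nonneg_right (le_abs_self c) (hV₀ _)) (le_abs_self m))
    _ ≤ gronwallBound (V x₀) |c| |m| T := by
      rw [hX.init, sub_zero]
      exact gronwallBound_mono (hV₀ x₀) (abs_nonneg m) (abs_nonneg c) hS.2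

section Coordinates

variable {ι : Type*} [Fintype ι]

theorem boundedAtFilter_coord_of_sum_mul_le {v : ℝ → (ι → ℝ) → ι → ℝ} {x₀ : ι → ℝ} {T c m : ℝ}
    (s : Finset ι)
    (hv : ∀ᵐ t, 0 ≤ t → ∀ x ∈ reachableSet v x₀ T,
      ∑ i ∈ s, x i * v t x i ≤ c * ∑ i ∈ s, x i ^ 2 + m) {i : ι} (hi : i ∈ s) :
    BoundedAtFilter (𝓟 (reachableSet v x₀ T)) fun x => x i := by
  have hV : BoundedAtFilter (𝓟 (reachableSet v x₀ T)) fun x => ∑ i ∈ s, x i ^ 2 := by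
    refine boundedAtFilter_reachableSet_of_deriv_le (c := 2 * c) (m := 2 * m)
      (ContDiff.locallyLipschitz (𝕂 := ℝ) (by fun_prop)) (fun x => by positivity) ?_
    filter_upwards [hv] with t ht ht₀ X hXt hX
    rw [(HasDerivAt.fun_sum fun i _ => (hasDerivAt_pi.1 hX i).fun_pow 2).deriv]
    calc
      _ = 2 * ∑ i ∈ s, X t i * v t (X t) i := by
        simp only [Nat.cast_ofNat, Nat.add_one_sub_one, pow_one, mul_assoc, Finset.mul_sum]
      _ ≤ _ := by linarith [ht ht₀ (X t) hXt]
  refine boundedAtFilter_of_sq_le (C := 1) hV fun x => ?_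
  rw [one_mul]
  exact Finset.single_le_sum (f := fun j => x j ^ 2) (fun j _ => sq_nonneg _) hi

theorem exists_forall_isCaratheodorySolution {f : (ι → ℝ) → ι → ℝ} {d : ℝ → ι → ℝ} {x₀ : ι → ℝ}
    (hf : LocallyLipschitz f) (hd : ∀ T, 0 ≤ T → IntervalIntegrable d volume 0 T)
    (hbdd : ∀ T, 0 ≤ T → ∀ i,
      BoundedAtFilter (𝓟 (reachableSet (fun t x => f x + d t) x₀ T)) fun x => x i) :
    ∃ X, ∀ T, 0 ≤ T → IsCaratheodorySolution (fun t x => f x + d t) x₀ T X := by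
  refine IsCaratheodorySolution.exists_forall_of_forall_exists hf fun T hT => ?_
  obtain ⟨B, hB⟩ := boundedAtFilter_principal_iff.1 (Asymptotics.isBigO_pi.2 (hbdd T hT))
  exact IsCaratheodorySolution.exists_of_apriori_bound hT hf (hd T hT) fun S hS X hX =>
    hB (X S) (hX.mem_reachableSet hS.2 ⟨hS.1, le_rfl⟩)

end Coordinates

end ReachableSet

namespace GFM

section Saturation

variable {S : EReal}

theorem sat_top (y : ℝ) : sat ⊤ y = y := by
  simp only [sat, not_top_lt, EReal.neg_top, not_lt_bot, if_false]

theorem sat_coe {r : ℝ} (hr : 0 < r) (y : ℝ) : sat r y = max (-r) (min r y) := by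
  simp only [sat, ← EReal.coe_neg, EReal.coe_lt_coe_iff, EReal.toReal_coe]
  grind

theorem abs_sat_coe_le {r : ℝ} (hr : 0 < r) (y : ℝ) : |sat r y| ≤ r := by
  rw [sat_coe hr, abs_le]
  exact ⟨le_max_left _ _, max_le (by linarith) (min_le_left _ _)⟩

theorem lipschitzWith_sat (hS : 0 < S) : LipschitzWith 1 (sat S) := by
  induction S with
  | bot => exact absurd hS not_lt_bot
  | top => simpa only [funext sat_top] using! LipschitzWith.id
  | coe r =>
    rw [funext (sat_coe (EReal.coe_pos.1 hS))]
    exact (LipschitzWith.id.const_min r).const_max (-r)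

theorem abs_sat_le_abs (hS : 0 < S) (y : ℝ) : |sat S y| ≤ |y| := by
  have h₀ : sat S 0 = 0 := by
    simp only [sat, EReal.coe_zero, hS.not_gt, EReal.lt_neg_comm (a := 0), neg_zero, if_false]
  simpa only [NNReal.coe_one, one_mul, Real.norm_eq_abs] using
    (lipschitzWith_sat hS).norm_le_mul h₀ y

end Saturation

section Regularity

variable {F : FilterParams} {N : NetworkParams} {D : DesignParams}

theorem locallyLipschitz_coord (c : Coord) : LocallyLipschitz fun x : State => x c :=
  ContDiff.locallyLipschitz (𝕂 := ℝ) (by fun_prop)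

theorem locallyLipschitz_Wd : LocallyLipschitz (Wd F D) :=
  ContDiff.locallyLipschitz (𝕂 := ℝ) (by unfold Wd itdRef freq vcdRef; fun_prop)

theorem locallyLipschitz_Wq : LocallyLipschitz (Wq F D) :=
  ContDiff.locallyLipschitz (𝕂 := ℝ) (by unfold Wq itqRef freq; fun_prop)

theorem locallyLipschitz_sat_reactivePower {S : EReal} (hS : 0 < S) :
    LocallyLipschitz fun x => sat S (reactivePower x) :=
  (lipschitzWith_sat hS).locallyLipschitz.comp <|
    ContDiff.locallyLipschitz (𝕂 := ℝ) (by unfold reactivePower; fun_prop)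

theorem locallyLipschitz_sat_activePower {S : EReal} (hS : 0 < S) :
    LocallyLipschitz fun x => sat S (activePower x) :=
  (lipschitzWith_sat hS).locallyLipschitz.comp <|
    ContDiff.locallyLipschitz (𝕂 := ℝ) (by unfold activePower; fun_prop)

theorem locallyLipschitz_vtd (hQ : 0 < D.Qbar) : LocallyLipschitz (vtd F D) := by
  have hsmooth : ContDiff ℝ 1 fun x : State =>
      -2 * F.ωb * freq D x * (x .itq - x .igq) + F.ωb * F.Rf / F.Lf * x .itd
      + F.ωb * (1 / F.Lf + freq D x ^ 2 * F.Cf) * x .vcd + F.Cf * D.KP * x .p2 * x .vcq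
      - D.KVC * (x .itd - itdRef F D x)
      + F.Cf * D.KVC ^ 2 / F.ωb * (x .vcd - vcdRef D x)
      + 2 * D.ξq * D.ωqc * D.KQ * F.Cf / F.ωb * x .q2 := by
    unfold itdRef freq vcdRef; fun_prop
  have hu : ContDiff ℝ 1 (ud F D) := by unfold ud itdRef freq vcdRef; fun_prop
  exact locallyLipschitz_mul (.const _) <| (hsmooth.locallyLipschitz.add <|
    locallyLipschitz_mul (.const _) <| (locallyLipschitz_coord .q1).sub <|
      locallyLipschitz_sat_reactivePower (EReal.coe_pos.2 hQ)).add hu.locallyLipschitz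

theorem locallyLipschitz_vtq : LocallyLipschitz (vtq F D) :=
  ContDiff.locallyLipschitz (𝕂 := ℝ) (by unfold vtq uq itqRef freq; fun_prop)

theorem locallyLipschitz_closedLoop (hQ : 0 < D.Qbar) (hP : 0 < D.Pbar) (vgd vgq : ℝ) :
    LocallyLipschitz fun x => closedLoop F N D x vgd vgq := by
  have hsmooth : ∀ {g : State → ℝ}, ContDiff ℝ 1 g → LocallyLipschitz g :=
    ContDiff.locallyLipschitz
  refine locallyLipschitz_pi fun i => ?_
  cases i <;> simp only [closedLoop]
  case itd =>
    exact ((hsmooth (by unfold freq; fun_prop)).add <| locallyLipschitz_mul (.const _) <|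
      (locallyLipschitz_vtd hQ).sub (locallyLipschitz_coord .vcd)).sub (hsmooth (by fun_prop))
  case itq =>
    exact ((hsmooth (by unfold freq; fun_prop)).add <| locallyLipschitz_mul (.const _) <|
      locallyLipschitz_vtq.sub (locallyLipschitz_coord .vcq)).sub (hsmooth (by fun_prop))
  case q1 => exact locallyLipschitz_coord .q2
  case p1 => exact locallyLipschitz_coord .p2
  case q2 =>
    exact (hsmooth (by fun_prop)).sub <| locallyLipschitz_mul (.const _) <|
      (locallyLipschitz_coord .q1).sub <|
        locallyLipschitz_sat_reactivePower (EReal.coe_pos.2 hQ)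
  case p2 =>
    exact (hsmooth (by fun_prop)).sub <| locallyLipschitz_mul (.const _) <|
      (locallyLipschitz_coord .p1).sub (locallyLipschitz_sat_activePower hP)
  case zd =>
    exact locallyLipschitz_mul (hsmooth (by fun_prop)) <|
      (locallyLipschitz_Wd.sub (.const D.ε)).max_const 0
  case zq =>
    exact locallyLipschitz_mul (hsmooth (by fun_prop)) <|
      (locallyLipschitz_Wq.sub (.const D.ε)).max_const 0
  all_goals exact hsmooth (by unfold freq; fun_prop)

end Regularity

end GFM

theorem mul_le_of_sq_le {p r s b : ℝ} (hp : 0 < p) (h : s ^ 2 ≤ 4 * p * r) :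
    b * s ≤ p * b ^ 2 + r := by
  have h₁ : 0 ≤ 4 * p * (p * b ^ 2 + r - b * s) := by linarith [sq_nonneg (2 * p * b - s)]
  linarith [nonneg_of_mul_nonneg_right h₁ (by positivity)]

theorem sq_add_mul_sub_le (R i v w : ℝ) :
    (w + R * i - v) ^ 2 ≤ (1 + i ^ 2 + v ^ 2) * (1 + R ^ 2 + w ^ 2) := by
  linarith [sq_nonneg (w * i - R), sq_nonneg (w * v + 1), sq_nonneg (R * v + i)]

theorem mul_disturbance_le {L μ e : ℝ} (ωb R i v w b : ℝ) (hL : L ≠ 0) (hμ : 0 < μ) (he : 0 < e) :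
    b * (ωb / L * (w + R * i - v))
      ≤ e * ωb ^ 2 / (4 * μ) * (1 + i ^ 2 + v ^ 2) * b ^ 2
        + μ * (1 + R ^ 2 + w ^ 2) / L ^ 2 / e := by
  have hsq : ((w + R * i - v) / L) ^ 2 ≤ 4 * (e / (4 * μ) * (1 + i ^ 2 + v ^ 2))
      * (μ * (1 + R ^ 2 + w ^ 2) / L ^ 2 / e) :=
    calc
      _ = (w + R * i - v) ^ 2 / L ^ 2 := div_pow ..
      _ ≤ (1 + i ^ 2 + v ^ 2) * (1 + R ^ 2 + w ^ 2) / L ^ 2 := by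
        gcongr
        exact sq_add_mul_sub_le R i v w
      _ = _ := by field_simp
  calc
    _ = ωb * b * ((w + R * i - v) / L) := by ring
    _ ≤ _ := mul_le_of_sq_le (by positivity) hsq
    _ = _ := by ring

theorem deriv_energy_le_of_damping {a b : ℝ → ℝ} {t KVC KCC c ωb L R μ e i v w k m : ℝ}
    (hL : L ≠ 0) (hμ : 0 < μ) (he : 0 < e) (hkV : k ≤ KVC) (hkC : k ≤ KCC) (hw : |w| ≤ m)
    (ha : HasDerivAt a (c * b t - KVC * a t) t)
    (hb : HasDerivAt b (-(KCC + e * ωb ^ 2 / (4 * μ) * (1 + i ^ 2 + v ^ 2)) * b t - c * a t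
      + ωb / L * (w + R * i - v)) t) :
    deriv (fun s => 1 / 2 * a s ^ 2 + 1 / 2 * b s ^ 2) t
      ≤ -2 * k * (1 / 2 * a t ^ 2 + 1 / 2 * b t ^ 2) + μ * (1 + R ^ 2 + m ^ 2) / L ^ 2 / e := by
  rw [(((ha.fun_pow 2).const_mul (1 / 2)).fun_add ((hb.fun_pow 2).const_mul (1 / 2))).deriv]
  have hwm : μ * (1 + R ^ 2 + w ^ 2) / L ^ 2 / e ≤ μ * (1 + R ^ 2 + m ^ 2) / L ^ 2 / e := by
    gcongr μ * (1 + R ^ 2 + ?_) / L ^ 2 / e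
    exact sq_le_sq.2 (hw.trans (le_abs_self m))
  have hdist := mul_disturbance_le ωb R i v w (b t) hL hμ he
  have hVa := mul_le_mul_of_nonneg_right hkV (sq_nonneg (a t))
  have hCb := mul_le_mul_of_nonneg_right hkC (sq_nonneg (b t))
  push_cast
  linarith

namespace GFM

section ErrorDynamics

variable {F : FilterParams} {N : NetworkParams} {D : DesignParams} {X : ℝ → State} {t vd vq : ℝ}

theorem hasDerivAt_vcd_error (hωb : F.ωb ≠ 0) (hCf : F.Cf ≠ 0)
    (hX : HasDerivAt X (closedLoop F N D (X t) vd vq) t) :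
    HasDerivAt (fun s => X s .vcd - vcdRef D (X s))
      (F.ωb / F.Cf * (X t .itd - itdRef F D (X t)) - D.KVC * (X t .vcd - vcdRef D (X t))) t := by
  have h := hasDerivAt_pi.1 hX
  convert! (h .vcd).sub ((((h .q1).const_sub D.Q0).const_mul D.KQ).const_add D.V0) using 1
  simp only [closedLoop, itdRef]
  field_simp
  ring

theorem hasDerivAt_vcq_error (hωb : F.ωb ≠ 0) (hCf : F.Cf ≠ 0)
    (hX : HasDerivAt X (closedLoop F N D (X t) vd vq) t) :
    HasDerivAt (fun s => X s .vcq)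
      (F.ωb / F.Cf * (X t .itq - itqRef F D (X t)) - D.KVC * X t .vcq) t := by
  convert! hasDerivAt_pi.1 hX .vcq using 1
  simp only [closedLoop, itqRef]
  field_simp
  ring

theorem hasDerivAt_freq (hX : HasDerivAt X (closedLoop F N D (X t) vd vq) t) :
    HasDerivAt (fun s => freq D (X s)) (D.KP * -X t .p2) t :=
  (((hasDerivAt_pi.1 hX .p1).const_sub D.P0).const_mul D.KP).const_add D.ω0

theorem hasDerivAt_itd_error (hωb : F.ωb ≠ 0) (hCf : F.Cf ≠ 0) (hLf : F.Lf ≠ 0)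
    (hX : HasDerivAt X (closedLoop F N D (X t) vd vq) t) :
    HasDerivAt (fun s => X s .itd - itdRef F D (X s))
      (ud F D (X t) + F.ωb / N.L * (vd + N.R * X t .igd - X t .vcd)) t := by
  have h := hasDerivAt_pi.1 hX
  have hder := (h .itd).sub ((((h .igd).sub (((hasDerivAt_freq hX).const_mul F.Cf).mul
    (h .vcq))).sub ((h .q2).const_mul (F.Cf * D.KQ / F.ωb))).sub
    ((hasDerivAt_vcd_error hωb hCf hX).const_mul (F.Cf * D.KVC / F.ωb)))
  convert! hder using 1
  simp only [closedLoop, vtd]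
  field_simp
  ring

theorem hasDerivAt_itq_error (hωb : F.ωb ≠ 0) (hCf : F.Cf ≠ 0) (hLf : F.Lf ≠ 0)
    (hX : HasDerivAt X (closedLoop F N D (X t) vd vq) t) :
    HasDerivAt (fun s => X s .itq - itqRef F D (X s))
      (uq F D (X t) + F.ωb / N.L * (vq + N.R * X t .igq - X t .vcq)) t := by
  have h := hasDerivAt_pi.1 hX
  have hder := (h .itq).sub (((h .igq).add (((hasDerivAt_freq hX).const_mul F.Cf).mul
    (h .vcd))).sub ((hasDerivAt_vcq_error hωb hCf hX).const_mul (F.Cf * D.KVC / F.ωb)))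
  convert! hder using 1
  simp only [closedLoop, vtq]
  field_simp
  ring

theorem deriv_Wd_le {k m : ℝ} (hωb : F.ωb ≠ 0) (hCf : F.Cf ≠ 0) (hLf : F.Lf ≠ 0) (hL : N.L ≠ 0)
    (hμ : 0 < D.μd) (hkV : k ≤ D.KVC) (hkC : k ≤ D.KCC) (hv : |vd| ≤ m)
    (hX : HasDerivAt X (closedLoop F N D (X t) vd vq) t) :
    deriv (fun s => Wd F D (X s)) t ≤ -2 * k * Wd F D (X t)
      + D.μd * (1 + N.R ^ 2 + m ^ 2) / N.L ^ 2 / (1 + Real.exp (X t .zd)) :=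
  deriv_energy_le_of_damping hL hμ (by positivity) hkV hkC hv (hasDerivAt_vcd_error hωb hCf hX)
    (hasDerivAt_itd_error hωb hCf hLf hX)

theorem deriv_Wq_le {k m : ℝ} (hωb : F.ωb ≠ 0) (hCf : F.Cf ≠ 0) (hLf : F.Lf ≠ 0) (hL : N.L ≠ 0)
    (hμ : 0 < D.μq) (hkV : k ≤ D.KVC) (hkC : k ≤ D.KCC) (hv : |vq| ≤ m)
    (hX : HasDerivAt X (closedLoop F N D (X t) vd vq) t) :
    deriv (fun s => Wq F D (X s)) t ≤ -2 * k * Wq F D (X t)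
      + D.μq * (1 + N.R ^ 2 + m ^ 2) / N.L ^ 2 / (1 + Real.exp (X t .zq)) :=
  deriv_energy_le_of_damping hL hμ (by positivity) hkV hkC hv (hasDerivAt_vcq_error hωb hCf hX)
    (hasDerivAt_itq_error hωb hCf hLf hX)

end ErrorDynamics

end GFM

section Subsystems

variable {ι : Type*} [Fintype ι] {v : ℝ → (ι → ℝ) → ι → ℝ} {x₀ : ι → ℝ} {T : ℝ}

theorem lowPass_power_le {x y s S : ℝ} (ξ w : ℝ) (hs : |s| ≤ S) :
    x * y + y * (-2 * ξ * w * y - w ^ 2 * (x - s))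
      ≤ (1 / 2 + 2 * |ξ * w| + w ^ 2) * (x ^ 2 + y ^ 2) + w ^ 2 * S ^ 2 / 2 := by
  have hsS : w ^ 2 * s ^ 2 ≤ w ^ 2 * S ^ 2 :=
    mul_le_mul_of_nonneg_left (sq_le_sq.2 (hs.trans (le_abs_self S))) (sq_nonneg w)
  have hξ : -(ξ * w) * y ^ 2 ≤ |ξ * w| * y ^ 2 :=
    mul_le_mul_of_nonneg_right (neg_le_abs _) (sq_nonneg y)
  have hx : 0 ≤ |ξ * w| * x ^ 2 := by positivity
  linarith [sq_nonneg (x - y), mul_nonneg (sq_nonneg w) (sq_nonneg (x + y)),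
    mul_nonneg (sq_nonneg w) (sq_nonneg (y - s)), mul_nonneg (sq_nonneg w) (sq_nonneg x)]

theorem mul_mul_le_abs_mul_sq_add_sq {i p B : ℝ} (α : ℝ) (hp : |p| ≤ B) :
    α * (i * p) ≤ |α| * (i ^ 2 + B ^ 2) :=
  calc
    α * (i * p) ≤ |α| * (|i| * |p|) := by
      rw [← abs_mul, ← abs_mul]
      exact le_abs_self _
    _ ≤ |α| * (|i| ^ 2 + |p| ^ 2) := by
      gcongr
      linarith [two_mul_le_add_sq |i| |p|, sq_nonneg |i|, sq_nonneg |p|]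
    _ ≤ |α| * (i ^ 2 + B ^ 2) := by
      rw [sq_abs i]
      gcongr

theorem rotating_power_le {i j p q B C : ℝ} (α β r : ℝ) (hp : |p| ≤ B) (hq : |q| ≤ C) :
    i * (r * j + α * p - β * i) + j * (-r * i + α * q - β * j)
      ≤ (|α| + |β|) * (i ^ 2 + j ^ 2) + |α| * (B ^ 2 + C ^ 2) := by
  have hip := mul_mul_le_abs_mul_sq_add_sq (i := i) α hp
  have hjq := mul_mul_le_abs_mul_sq_add_sq (i := j) α hq
  have hβ : -β * (i ^ 2 + j ^ 2) ≤ |β| * (i ^ 2 + j ^ 2) := by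
    gcongr
    exact neg_le_abs β
  linarith

theorem boundedAtFilter_coord_of_lowPass {a b : ι} {ξ w : ℝ} {s : (ι → ℝ) → ℝ} (hab : a ≠ b)
    (hs : BoundedAtFilter (𝓟 (reachableSet v x₀ T)) s) (hva : ∀ t x, v t x a = x b)
    (hvb : ∀ t x, v t x b = -2 * ξ * w * x b - w ^ 2 * (x a - s x)) :
    BoundedAtFilter (𝓟 (reachableSet v x₀ T)) (fun x => x a) ∧
      BoundedAtFilter (𝓟 (reachableSet v x₀ T)) (fun x => x b) := by
  classical
  obtain ⟨S, hS⟩ := boundedAtFilter_principal_iff.1 hs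
  have hpower : ∀ᵐ t, 0 ≤ t → ∀ x ∈ reachableSet v x₀ T, ∑ i ∈ {a, b}, x i * v t x i
      ≤ (1 / 2 + 2 * |ξ * w| + w ^ 2) * ∑ i ∈ {a, b}, x i ^ 2 + w ^ 2 * S ^ 2 / 2 :=
    ae_of_all _ fun t _ x hx => by
      rw [Finset.sum_pair hab, Finset.sum_pair hab, hva, hvb]
      exact lowPass_power_le ξ w (hS x hx)
  exact ⟨boundedAtFilter_coord_of_sum_mul_le {a, b} hpower (Finset.mem_insert_self a {b}),
    boundedAtFilter_coord_of_sum_mul_le {a, b} hpower (by simp)⟩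

theorem boundedAtFilter_coord_of_adaptive {i : ι} {Γ ε : ℝ} {W : (ι → ℝ) → ℝ} (hΓ : 0 ≤ Γ)
    (hW : BoundedAtFilter (𝓟 (reachableSet v x₀ T)) W)
    (hvi : ∀ t x, v t x i = Γ * Real.exp (-x i) * max (W x - ε) 0) :
    BoundedAtFilter (𝓟 (reachableSet v x₀ T)) fun x => x i := by
  obtain ⟨B, hB⟩ := boundedAtFilter_principal_iff.1 hW
  refine boundedAtFilter_coord_of_sum_mul_le (c := 0) (m := Γ * 1 * max (B - ε) 0) {i}
    (ae_of_all _ fun t _ x hx => ?_) (Finset.mem_singleton_self i)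
  have hexp : x i * Real.exp (-x i) ≤ 1 :=
    (Real.mul_exp_neg_le_exp_neg_one _).trans (Real.exp_le_one_iff.2 (by norm_num))
  calc
    ∑ j ∈ {i}, x j * v t x j = Γ * (x i * Real.exp (-x i)) * max (W x - ε) 0 := by
      rw [Finset.sum_singleton, hvi]
      ring
    _ ≤ Γ * 1 * max (B - ε) 0 := by
      gcongr
      exact (le_abs_self _).trans (hB x hx)
    _ = _ := by rw [zero_mul, zero_add]

end Subsystems

namespace GFM

variable {F : FilterParams} {N : NetworkParams} {D : DesignParams} {x₀ : State} {vgd vgq : ℝ → ℝ}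

section AprioriBounds

/-- The closed loop driven by the grid voltage signals, as a time-dependent vector field. -/
noncomputable def drivenLoop (F : FilterParams) (N : NetworkParams) (D : DesignParams)
    (vgd vgq : ℝ → ℝ) (t : ℝ) (x : State) : State :=
  closedLoop F N D x (vgd t) (vgq t)

theorem Wd_nonneg (x : State) : 0 ≤ Wd F D x := by unfold Wd; positivity

theorem Wq_nonneg (x : State) : 0 ≤ Wq F D x := by unfold Wq; positivity

theorem sq_vcd_error_le (x : State) : (x .vcd - vcdRef D x) ^ 2 ≤ 2 * Wd F D x := by
  unfold Wd
  linarith [sq_nonneg (x .itd - itdRef F D x)]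

theorem sq_itd_error_le (x : State) : (x .itd - itdRef F D x) ^ 2 ≤ 2 * Wd F D x := by
  unfold Wd
  linarith [sq_nonneg (x .vcd - vcdRef D x)]

theorem sq_vcq_le (x : State) : x .vcq ^ 2 ≤ 2 * Wq F D x := by
  unfold Wq
  linarith [sq_nonneg (x .itq - itqRef F D x)]

theorem sq_itq_error_le (x : State) : (x .itq - itqRef F D x) ^ 2 ≤ 2 * Wq F D x := by
  unfold Wq
  linarith [sq_nonneg (x .vcq)]

section Algebraic

variable {l : Filter State}

theorem boundedAtFilter_vcd (hW : BoundedAtFilter l (Wd F D))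
    (hq₁ : BoundedAtFilter l fun x => x .q1) : BoundedAtFilter l fun x => x .vcd := by
  have href : BoundedAtFilter l (vcdRef D) := (const_boundedAtFilter l D.V0).add
    ((const_boundedAtFilter l D.KQ).mul ((const_boundedAtFilter l D.Q0).sub hq₁))
  simpa only [Pi.add_def, sub_add_cancel] using
    (boundedAtFilter_of_sq_le hW sq_vcd_error_le).add href

theorem boundedAtFilter_freq (hp₁ : BoundedAtFilter l fun x => x .p1) :
    BoundedAtFilter l (freq D) :=
  (const_boundedAtFilter l D.ω0).add
    ((const_boundedAtFilter l D.KP).mul ((const_boundedAtFilter l D.P0).sub hp₁))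

theorem boundedAtFilter_itd (hW : BoundedAtFilter l (Wd F D))
    (hvcq : BoundedAtFilter l fun x => x .vcq) (higd : BoundedAtFilter l fun x => x .igd)
    (hp₁ : BoundedAtFilter l fun x => x .p1) (hq₂ : BoundedAtFilter l fun x => x .q2) :
    BoundedAtFilter l fun x => x .itd := by
  have href : BoundedAtFilter l (itdRef F D) := ((higd.sub
    (((const_boundedAtFilter l _).mul (boundedAtFilter_freq hp₁)).mul hvcq)).sub
    ((const_boundedAtFilter l _).mul hq₂)).sub
    ((const_boundedAtFilter l _).mul (boundedAtFilter_of_sq_le hW sq_vcd_error_le))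
  simpa only [Pi.add_def, sub_add_cancel] using
    (boundedAtFilter_of_sq_le hW sq_itd_error_le).add href

theorem boundedAtFilter_itq (hW : BoundedAtFilter l (Wq F D))
    (hvcd : BoundedAtFilter l fun x => x .vcd) (higq : BoundedAtFilter l fun x => x .igq)
    (hp₁ : BoundedAtFilter l fun x => x .p1) : BoundedAtFilter l fun x => x .itq := by
  have href : BoundedAtFilter l (itqRef F D) := (BoundedAtFilter.add higq
    (((const_boundedAtFilter l _).mul (boundedAtFilter_freq hp₁)).mul hvcd)).sub
    ((const_boundedAtFilter l _).mul (boundedAtFilter_of_sq_le hW sq_vcq_le))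
  simpa only [Pi.add_def, sub_add_cancel] using
    (boundedAtFilter_of_sq_le hW sq_itq_error_le).add href

end Algebraic

variable {T md mq : ℝ}

theorem boundedAtFilter_Wd (hωb : F.ωb ≠ 0) (hCf : F.Cf ≠ 0) (hLf : F.Lf ≠ 0) (hL : N.L ≠ 0)
    (hμ : 0 < D.μd) (hv : ∀ᵐ t, 0 ≤ t → |vgd t| ≤ md) :
    BoundedAtFilter (𝓟 (reachableSet (drivenLoop F N D vgd vgq) x₀ T)) (Wd F D) := by
  refine boundedAtFilter_reachableSet_of_deriv_le (c := -2 * min D.KVC D.KCC)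
    (m := D.μd * (1 + N.R ^ 2 + md ^ 2) / N.L ^ 2) locallyLipschitz_Wd Wd_nonneg ?_
  filter_upwards [hv] with t ht ht₀ X _ hX
  refine (deriv_Wd_le hωb hCf hLf hL hμ (min_le_left _ _) (min_le_right _ _) (ht ht₀) hX).trans ?_
  exact add_le_add le_rfl
    (div_le_self (by positivity) (le_add_of_nonneg_right (Real.exp_pos _).le))

theorem boundedAtFilter_Wq (hωb : F.ωb ≠ 0) (hCf : F.Cf ≠ 0) (hLf : F.Lf ≠ 0) (hL : N.L ≠ 0)
    (hμ : 0 < D.μq) (hv : ∀ᵐ t, 0 ≤ t → |vgq t| ≤ mq) :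
    BoundedAtFilter (𝓟 (reachableSet (drivenLoop F N D vgd vgq) x₀ T)) (Wq F D) := by
  refine boundedAtFilter_reachableSet_of_deriv_le (c := -2 * min D.KVC D.KCC)
    (m := D.μq * (1 + N.R ^ 2 + mq ^ 2) / N.L ^ 2) locallyLipschitz_Wq Wq_nonneg ?_
  filter_upwards [hv] with t ht ht₀ X _ hX
  refine (deriv_Wq_le hωb hCf hLf hL hμ (min_le_left _ _) (min_le_right _ _) (ht ht₀) hX).trans ?_
  exact add_le_add le_rfl
    (div_le_self (by positivity) (le_add_of_nonneg_right (Real.exp_pos _).le))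

theorem boundedAtFilter_gridCurrents
    (hd : ∀ᵐ t, 0 ≤ t → |vgd t| ≤ md) (hq : ∀ᵐ t, 0 ≤ t → |vgq t| ≤ mq)
    (hvcd : BoundedAtFilter (𝓟 (reachableSet (drivenLoop F N D vgd vgq) x₀ T)) fun x => x .vcd)
    (hvcq : BoundedAtFilter (𝓟 (reachableSet (drivenLoop F N D vgd vgq) x₀ T)) fun x => x .vcq) :
    BoundedAtFilter (𝓟 (reachableSet (drivenLoop F N D vgd vgq) x₀ T)) (fun x => x .igd) ∧
      BoundedAtFilter (𝓟 (reachableSet (drivenLoop F N D vgd vgq) x₀ T)) (fun x => x .igq) := by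
  obtain ⟨B, hB⟩ := boundedAtFilter_principal_iff.1 hvcd
  obtain ⟨C, hC⟩ := boundedAtFilter_principal_iff.1 hvcq
  have hpower : ∀ᵐ t, 0 ≤ t → ∀ x ∈ reachableSet (drivenLoop F N D vgd vgq) x₀ T,
      ∑ i ∈ {Coord.igd, Coord.igq}, x i * drivenLoop F N D vgd vgq t x i
        ≤ (|F.ωb / N.L| + |F.ωb * N.R / N.L|) * ∑ i ∈ {Coord.igd, Coord.igq}, x i ^ 2
          + |F.ωb / N.L| * ((B + md) ^ 2 + (C + mq) ^ 2) := by
    filter_upwards [hd, hq] with t htd htq ht x hx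
    rw [Finset.sum_pair (by decide), Finset.sum_pair (by decide), drivenLoop, closedLoop,
      closedLoop, neg_mul F.ωb]
    exact rotating_power_le _ _ _ ((abs_sub _ _).trans (add_le_add (hB x hx) (htd ht)))
      ((abs_sub _ _).trans (add_le_add (hC x hx) (htq ht)))
  exact ⟨boundedAtFilter_coord_of_sum_mul_le _ hpower (by simp),
    boundedAtFilter_coord_of_sum_mul_le _ hpower (by simp)⟩

theorem boundedAtFilter_coord (hωb : F.ωb ≠ 0) (hCf : F.Cf ≠ 0) (hLf : F.Lf ≠ 0) (hL : N.L ≠ 0)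
    (hμd : 0 < D.μd) (hμq : 0 < D.μq) (hΓd : 0 ≤ D.Γd) (hΓq : 0 ≤ D.Γq)
    (hQ : 0 < D.Qbar) (hP : 0 < D.Pbar)
    (hd : ∀ᵐ t, 0 ≤ t → |vgd t| ≤ md) (hq : ∀ᵐ t, 0 ≤ t → |vgq t| ≤ mq) (i : Coord) :
    BoundedAtFilter (𝓟 (reachableSet (drivenLoop F N D vgd vgq) x₀ T)) fun x => x i := by
  set l := 𝓟 (reachableSet (drivenLoop F N D vgd vgq) x₀ T)
  have hWd : BoundedAtFilter l (Wd F D) := boundedAtFilter_Wd hωb hCf hLf hL hμd hd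
  have hWq : BoundedAtFilter l (Wq F D) := boundedAtFilter_Wq hωb hCf hLf hL hμq hq
  have hvcq : BoundedAtFilter l fun x => x .vcq := boundedAtFilter_of_sq_le hWq sq_vcq_le
  have hsatQ : BoundedAtFilter l fun x => sat D.Qbar (reactivePower x) :=
    boundedAtFilter_principal_iff.2 ⟨D.Qbar, fun x _ => abs_sat_coe_le hQ _⟩
  obtain ⟨hq₁, hq₂⟩ := boundedAtFilter_coord_of_lowPass (a := Coord.q1) (b := .q2) (by decide)
    hsatQ (fun _ _ => rfl) fun _ _ => rfl
  have hvcd := boundedAtFilter_vcd hWd hq₁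
  obtain ⟨higd, higq⟩ := boundedAtFilter_gridCurrents hd hq hvcd hvcq
  have hpower : BoundedAtFilter l activePower := (hvcd.mul higd).add (hvcq.mul higq)
  have hsatP : BoundedAtFilter l fun x => sat D.Pbar (activePower x) :=
    (Asymptotics.isBigO_of_le l fun x => abs_sat_le_abs hP _).trans hpower
  obtain ⟨hp₁, hp₂⟩ := boundedAtFilter_coord_of_lowPass (a := Coord.p1) (b := .p2) (by decide)
    hsatP (fun _ _ => rfl) fun _ _ => rfl
  have hitd := boundedAtFilter_itd hWd hvcq higd hp₁ hq₂
  have hitq := boundedAtFilter_itq hWq hvcd higq hp₁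
  have hzd := boundedAtFilter_coord_of_adaptive (i := Coord.zd) hΓd hWd fun _ _ => rfl
  have hzq := boundedAtFilter_coord_of_adaptive (i := Coord.zq) hΓq hWq fun _ _ => rfl
  cases i <;> assumption

end AprioriBounds

end GFM

section AdaptiveDamping

open Set

/-- An energy `W` is adaptively damped by a gain `z` when it decays at rate `2 * k` up to a
disturbance of size `M` that is attenuated by the factor `1 + exp z`, while the gain grows, with
adaptation rate `Γ`, only as long as the energy exceeds the dead-zone level `ε`. The equations hold
almost everywhere on `[0, ∞)`. -/
structure IsAdaptivelyDamped (k M Γ ε : ℝ) (W z : ℝ → ℝ) : Prop where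
  energy_nonneg : ∀ t, 0 ≤ W t
  absCont_energy : ∀ a b, 0 ≤ a → a ≤ b → AbsolutelyContinuousOnInterval W a b
  absCont_gain : ∀ a b, 0 ≤ a → a ≤ b → AbsolutelyContinuousOnInterval z a b
  deriv_energy_le : ∀ᵐ t, 0 ≤ t → deriv W t ≤ -2 * k * W t + M / (1 + Real.exp (z t))
  deriv_gain : ∀ᵐ t, 0 ≤ t → deriv z t = Γ * Real.exp (-z t) * max (W t - ε) 0

namespace IsAdaptivelyDamped

variable {k M Γ ε : ℝ} {W z : ℝ → ℝ}

theorem two_mul_energy_le (h : IsAdaptivelyDamped k M Γ ε W z) (hk : 0 < k) (hM : 0 ≤ M) {t : ℝ}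
    (ht : 0 ≤ t) : 2 * W t ≤ 2 * Real.exp (-2 * k * t) * W 0 + M / k := by
  have hW := le_gronwallBound_of_ae_deriv_le ht (h.absCont_energy 0 t le_rfl ht) (by
    filter_upwards [h.deriv_energy_le] with s hs hsm
    exact (hs hsm.1).trans <| add_le_add le_rfl <|
      div_le_self hM (le_add_of_nonneg_right (Real.exp_pos _).le))
  rw [gronwallBound_of_K_ne_0 (mul_ne_zero (by norm_num) hk.ne'), sub_zero] at hW
  calc
    2 * W t ≤ 2 * (W 0 * Real.exp (-2 * k * t) + M / (-2 * k) * (Real.exp (-2 * k * t) - 1)) := by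
      gcongr
    _ = 2 * Real.exp (-2 * k * t) * W 0 + M / k - Real.exp (-2 * k * t) * (M / k) := by
      field_simp
      ring
    _ ≤ _ := sub_le_self _ (by positivity)

theorem energy_le_add (h : IsAdaptivelyDamped k M Γ ε W z) (hk : 0 ≤ k) (hM : 0 ≤ M) {a b : ℝ}
    (ha : 0 ≤ a) (hab : a ≤ b) : W b ≤ W a + M * (b - a) := by
  refine le_add_mul_of_ae_deriv_le hab (h.absCont_energy a b ha hab) ?_
  filter_upwards [h.deriv_energy_le] with t ht htm
  have hdecay : 0 ≤ k * W t := mul_nonneg hk (h.energy_nonneg t)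
  have hdist : M / (1 + Real.exp (z t)) ≤ M :=
    div_le_self hM (le_add_of_nonneg_right (Real.exp_pos _).le)
  linarith [ht (ha.trans htm.1)]

theorem gain_add_le (h : IsAdaptivelyDamped k M Γ ε W z) (hΓ : 0 ≤ Γ) {a b Z η : ℝ} (ha : 0 ≤ a)
    (hab : a ≤ b) (hη : 0 ≤ η) (hZ : ∀ t ∈ Icc a b, z t ≤ Z)
    (hW : ∀ t ∈ Icc a b, η ≤ max (W t - ε) 0) : z a + Γ * Real.exp (-Z) * η * (b - a) ≤ z b := by
  have hz := le_add_mul_of_ae_deriv_le (m := -(Γ * Real.exp (-Z) * η)) hab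
    (h.absCont_gain a b ha hab).fun_neg (by
      filter_upwards [h.deriv_gain] with t ht htm
      rw [deriv.fun_neg, ht (ha.trans htm.1), neg_le_neg_iff]
      have := hZ t htm
      have := hW t htm
      gcongr)
  linarith

theorem monotoneOn_gain (h : IsAdaptivelyDamped k M Γ ε W z) (hΓ : 0 ≤ Γ) :
    MonotoneOn z (Ici 0) := by
  intro a ha b _ hab
  obtain ⟨Z, hZ⟩ := isCompact_uIcc.bddAbove_image (h.absCont_gain a b ha hab).continuousOn
  have := h.gain_add_le hΓ ha hab le_rfl
    (fun t ht => hZ (mem_image_of_mem z (Icc_subset_uIcc ht))) fun t _ => le_max_right _ _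
  linarith

-- Were `W t > ε + δ` at a late time `t`, then `W > ε + δ / 2` on an interval of fixed length before
-- `t`, as `W` grows at most linearly, and `z` would gain a fixed amount there, exceeding its limit.
theorem eventually_energy_le_of_bddAbove_gain (h : IsAdaptivelyDamped k M Γ ε W z) (hk : 0 ≤ k)
    (hM : 0 ≤ M) (hΓ : 0 < Γ) {δ : ℝ} (hδ : 0 < δ) (hz : BddAbove (z '' Ici 0)) :
    ∀ᶠ t in atTop, W t ≤ ε + δ := by
  set τ := δ / (2 * (M + 1))
  set ℓ := sSup (z '' Ici 0)
  have hτ : 0 < τ := by positivity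
  have hMτ : M * τ ≤ δ / 2 := by
    have : (M + 1) * τ = δ / 2 := by
      simp only [τ]
      field_simp
    linarith
  have hle : ∀ t, 0 ≤ t → z t ≤ ℓ := fun t ht => le_csSup hz (mem_image_of_mem z ht)
  obtain ⟨_, ⟨t₀, ht₀ : 0 ≤ t₀, rfl⟩, hlt⟩ := exists_lt_of_lt_csSup (nonempty_Ici.image z)
    (sub_lt_self ℓ (by positivity : 0 < Γ * Real.exp (-ℓ) * (δ / 2) * τ))
  filter_upwards [eventually_ge_atTop (t₀ + τ)] with t ht
  by_contra! hWt
  have hstart : t₀ ≤ t - τ := by linarith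
  have hlarge : ∀ s ∈ Icc (t - τ) t, δ / 2 ≤ max (W s - ε) 0 := by
    intro s hs
    have hgrowth := h.energy_le_add hk hM (ht₀.trans (hstart.trans hs.1)) hs.2
    have : M * (t - s) ≤ M * τ := mul_le_mul_of_nonneg_left (by linarith [hs.1]) hM
    exact le_max_of_le_left (by linarith)
  have hgain := h.gain_add_le hΓ.le (ht₀.trans hstart) (sub_le_self t hτ.le) (half_pos hδ).le
    (fun s hs => hle s (ht₀.trans (hstart.trans hs.1))) hlarge
  have hmono := h.monotoneOn_gain hΓ.le ht₀ (ht₀.trans hstart) hstart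
  rw [sub_sub_cancel] at hgain
  linarith [hle t (by linarith)]

theorem eventually_energy_le_of_not_bddAbove_gain (h : IsAdaptivelyDamped k M Γ ε W z) (hk : 0 < k)
    (hΓ : 0 ≤ Γ) {δ : ℝ} (hδ : 0 < δ) (hz : ¬BddAbove (z '' Ici 0)) :
    ∀ᶠ t in atTop, W t ≤ δ := by
  obtain ⟨_, ⟨t₀, ht₀, rfl⟩, hlt⟩ := not_bddAbove_iff.1 hz (M / (k * δ))
  have hdist : ∀ t, t₀ ≤ t → M / (1 + Real.exp (z t)) ≤ k * δ := by
    intro t ht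
    rw [div_le_comm₀ (by positivity) (by positivity)]
    linarith [h.monotoneOn_gain hΓ ht₀ (ht₀.trans ht) ht, Real.add_one_le_exp (z t)]
  have hW := eventually_le_of_ae_deriv_le (c := 2 * k) (m := k * δ) (by positivity) (half_pos hδ)
    (fun b hb => h.absCont_energy t₀ b ht₀ hb) (by
      filter_upwards [h.deriv_energy_le] with t ht htm
      linarith [ht (ht₀.trans htm), hdist t htm])
  filter_upwards [hW] with t ht
  have : k * δ / (2 * k) = δ / 2 := by field_simp
  linarith

theorem eventually_energy_le (h : IsAdaptivelyDamped k M Γ ε W z) (hk : 0 < k) (hM : 0 ≤ M)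
    (hΓ : 0 < Γ) (hε : 0 ≤ ε) {δ : ℝ} (hδ : 0 < δ) : ∀ᶠ t in atTop, W t ≤ ε + δ := by
  by_cases hz : BddAbove (z '' Ici 0)
  · exact h.eventually_energy_le_of_bddAbove_gain hk.le hM hΓ hδ hz
  · filter_upwards [h.eventually_energy_le_of_not_bddAbove_gain hk hΓ.le hδ hz] with t ht
    exact ht.trans (le_add_of_nonneg_left hε)

theorem limsup_abs_le_sqrt (h : IsAdaptivelyDamped k M Γ ε W z) (hk : 0 < k) (hM : 0 ≤ M)
    (hΓ : 0 < Γ) (hε : 0 ≤ ε) {e : ℝ → ℝ} (he : ∀ t, e t ^ 2 ≤ 2 * W t) :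
    limsup (fun t => ((|e t| : ℝ) : EReal)) atTop ≤ ((Real.sqrt (2 * ε) : ℝ) : EReal) := by
  refine EReal.le_of_forall_lt_iff_le.1 fun r hr => ?_
  have hsqrt : Real.sqrt (2 * ε) < r := EReal.coe_lt_coe_iff.1 hr
  have hr₀ : 0 < r := (Real.sqrt_nonneg _).trans_lt hsqrt
  have hgap : 2 * ε < r ^ 2 := (Real.sqrt_lt' hr₀).1 hsqrt
  refine limsup_le_of_le (h := ?_)
  filter_upwards [h.eventually_energy_le hk hM hΓ hε (δ := r ^ 2 / 2 - ε) (by linarith)] with t ht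
  exact EReal.coe_le_coe_iff.2 (abs_le_of_sq_le_sq (by linarith [he t]) hr₀.le)

end IsAdaptivelyDamped

end AdaptiveDamping

namespace GFM

section ClosedLoop

open Set

variable {F : FilterParams} {N : NetworkParams} {D : DesignParams} {x₀ : State} {vgd vgq : ℝ → ℝ}

theorem MemLinfty.ae_abs_le {v : ℝ → ℝ} (hv : MemLinfty v) :
    ∀ᵐ t, 0 ≤ t → |v t| ≤ normLinfty v := by
  have h := (ae_restrict_iff' measurableSet_Ici).1
    (enorm_ae_le_eLpNormEssSup v (volume.restrict (Ici (0 : ℝ))))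
  filter_upwards [h] with t ht ht₀
  simpa only [toReal_enorm, Real.norm_eq_abs, normLinfty] using
    ENNReal.toReal_mono hv.eLpNorm_lt_top.ne ((ht ht₀).trans_eq eLpNorm_exponent_top.symm)

theorem MemLinfty.intervalIntegrable {v : ℝ → ℝ} (hv : MemLinfty v) {T : ℝ} (hT : 0 ≤ T) :
    IntervalIntegrable v volume 0 T :=
  (intervalIntegrable_iff_integrableOn_Icc_of_le hT).2 <|
    (hv.mono_measure (Measure.restrict_mono Icc_subset_Ici_self le_rfl)).integrable le_top

/-- The contribution of the grid voltage to the closed loop, which enters it additively. -/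
noncomputable def gridForcing (F : FilterParams) (N : NetworkParams) (vgd vgq : ℝ → ℝ) (t : ℝ) :
    State :=
  vgd t • Pi.single Coord.igd (-(F.ωb / N.L)) + vgq t • Pi.single Coord.igq (-(F.ωb / N.L))

theorem drivenLoop_eq_add_gridForcing :
    drivenLoop F N D vgd vgq = fun t x => closedLoop F N D x 0 0 + gridForcing F N vgd vgq t := by
  funext t x i
  cases i <;> simp only [drivenLoop, closedLoop, gridForcing, Pi.add_apply, Pi.smul_apply,
    Pi.single_apply, reduceCtorEq, if_false, if_true, smul_eq_mul] <;> ring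

theorem intervalIntegrable_gridForcing (hd : MemLinfty vgd) (hq : MemLinfty vgq) {T : ℝ}
    (hT : 0 ≤ T) : IntervalIntegrable (gridForcing F N vgd vgq) volume 0 T :=
  ((hd.intervalIntegrable hT).smul_continuousOn continuousOn_const).add
    ((hq.intervalIntegrable hT).smul_continuousOn continuousOn_const)

theorem isSolution_iff {X : ℝ → State} : IsSolution F N D x₀ vgd vgq X ↔
    ∀ T, 0 ≤ T → IsCaratheodorySolution (drivenLoop F N D vgd vgq) x₀ T X := by
  refine ⟨fun h T hT => ⟨h.init, h.absCont T hT, ?_⟩,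
    fun h => ⟨(h 0 le_rfl).init, fun T hT => (h T hT).absCont,
      (ae_restrict_iff' measurableSet_Ici).2 ?_⟩⟩
  · filter_upwards [(ae_restrict_iff' measurableSet_Ici).1 h.ode] with t ht htm using ht htm.1
  · filter_upwards [ae_all_iff.2 fun n : ℕ => (h n n.cast_nonneg).ode] with t ht ht₀
    exact ht ⌈t⌉₊ ⟨ht₀, Nat.le_ceil t⟩

theorem exists_isSolution (hωb : F.ωb ≠ 0) (hCf : F.Cf ≠ 0) (hLf : F.Lf ≠ 0) (hL : N.L ≠ 0)
    (hμd : 0 < D.μd) (hμq : 0 < D.μq) (hΓd : 0 ≤ D.Γd) (hΓq : 0 ≤ D.Γq) (hQ : 0 < D.Qbar)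
    (hP : 0 < D.Pbar) (hd : MemLinfty vgd) (hq : MemLinfty vgq) (x₀ : State) :
    ∃ X, IsSolution F N D x₀ vgd vgq X := by
  simp only [isSolution_iff, drivenLoop_eq_add_gridForcing]
  refine exists_forall_isCaratheodorySolution (locallyLipschitz_closedLoop hQ hP 0 0)
    (fun T hT => intervalIntegrable_gridForcing hd hq hT) fun T _ => ?_
  rw [← drivenLoop_eq_add_gridForcing]
  exact boundedAtFilter_coord hωb hCf hLf hL hμd hμq hΓd hΓq hQ hP hd.ae_abs_le hq.ae_abs_le

namespace IsSolution

variable {X Y : ℝ → State}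

theorem eq_of_nonneg (hX : IsSolution F N D x₀ vgd vgq X) (hY : IsSolution F N D x₀ vgd vgq Y)
    (hQ : 0 < D.Qbar) (hP : 0 < D.Pbar) {t : ℝ} (ht : 0 ≤ t) : X t = Y t := by
  rw [isSolution_iff, drivenLoop_eq_add_gridForcing] at hX hY
  exact (hX t ht).eqOn (locallyLipschitz_closedLoop hQ hP 0 0) ht (hY t ht) (right_mem_Icc.2 ht)

theorem absCont_comp (hX : IsSolution F N D x₀ vgd vgq X) {g : State → ℝ} (hg : LocallyLipschitz g)
    (a b : ℝ) (ha : 0 ≤ a) (hab : a ≤ b) :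
    AbsolutelyContinuousOnInterval (fun t => g (X t)) a b :=
  absolutelyContinuousOnInterval_comp hg <| (hX.absCont b (ha.trans hab)).mono <|
    uIcc_subset_uIcc_right (mem_uIcc_of_le ha hab)

theorem isAdaptivelyDamped_Wd (hX : IsSolution F N D x₀ vgd vgq X) (hωb : F.ωb ≠ 0)
    (hCf : F.Cf ≠ 0) (hLf : F.Lf ≠ 0) (hL : N.L ≠ 0) (hμ : 0 < D.μd) (hv : MemLinfty vgd) :
    IsAdaptivelyDamped (min D.KVC D.KCC) (D.μd * (1 + N.R ^ 2 + normLinfty vgd ^ 2) / N.L ^ 2)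
      D.Γd D.ε (fun t => Wd F D (X t)) fun t => X t .zd where
  energy_nonneg t := Wd_nonneg (X t)
  absCont_energy := hX.absCont_comp (g := Wd F D) locallyLipschitz_Wd
  absCont_gain := hX.absCont_comp (g := fun x => x .zd) (locallyLipschitz_coord .zd)
  deriv_energy_le := by
    filter_upwards [(ae_restrict_iff' measurableSet_Ici).1 hX.ode, hv.ae_abs_le] with t ht htv ht₀
    exact deriv_Wd_le hωb hCf hLf hL hμ (min_le_left _ _) (min_le_right _ _) (htv ht₀) (ht ht₀)
  deriv_gain := by
    filter_upwards [(ae_restrict_iff' measurableSet_Ici).1 hX.ode] with t ht ht₀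
    exact (hasDerivAt_pi.1 (ht ht₀) .zd).deriv

theorem isAdaptivelyDamped_Wq (hX : IsSolution F N D x₀ vgd vgq X) (hωb : F.ωb ≠ 0)
    (hCf : F.Cf ≠ 0) (hLf : F.Lf ≠ 0) (hL : N.L ≠ 0) (hμ : 0 < D.μq) (hv : MemLinfty vgq) :
    IsAdaptivelyDamped (min D.KVC D.KCC) (D.μq * (1 + N.R ^ 2 + normLinfty vgq ^ 2) / N.L ^ 2)
      D.Γq D.ε (fun t => Wq F D (X t)) fun t => X t .zq where
  energy_nonneg t := Wq_nonneg (X t)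
  absCont_energy := hX.absCont_comp (g := Wq F D) locallyLipschitz_Wq
  absCont_gain := hX.absCont_comp (g := fun x => x .zq) (locallyLipschitz_coord .zq)
  deriv_energy_le := by
    filter_upwards [(ae_restrict_iff' measurableSet_Ici).1 hX.ode, hv.ae_abs_le] with t ht htv ht₀
    exact deriv_Wq_le hωb hCf hLf hL hμ (min_le_left _ _) (min_le_right _ _) (htv ht₀) (ht ht₀)
  deriv_gain := by
    filter_upwards [(ae_restrict_iff' measurableSet_Ici).1 hX.ode] with t ht ht₀
    exact (hasDerivAt_pi.1 (ht ht₀) .zq).deriv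

end IsSolution

end ClosedLoop

end GFM

theorem theorem2_general
    (F : GFM.FilterParams) (N : GFM.NetworkParams) (D : GFM.DesignParams)
    (hωb : F.ωb ≠ 0) (hCf : F.Cf ≠ 0) (hLf : F.Lf ≠ 0) (hL : N.L ≠ 0)
    (hKVC : 0 < D.KVC) (hKCC : 0 < D.KCC) (hμd : 0 < D.μd) (hμq : 0 < D.μq)
    (hΓd : 0 < D.Γd) (hΓq : 0 < D.Γq) (hε : 0 ≤ D.ε) (hQbar : 0 < D.Qbar) (hPbar : 0 < D.Pbar)
    (vgd vgq : ℝ → ℝ) (hvgd : GFM.MemLinfty vgd) (hvgq : GFM.MemLinfty vgq)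
    (x₀ : GFM.State) (k : ℝ) (hk : k = min D.KVC D.KCC) :
    ∃ X : ℝ → GFM.State,
      GFM.IsSolution F N D x₀ vgd vgq X ∧
      (∀ Y : ℝ → GFM.State, GFM.IsSolution F N D x₀ vgd vgq Y → ∀ t : ℝ, 0 ≤ t → Y t = X t) ∧
      (∀ t : ℝ, 0 ≤ t →
        (X t .vcd - GFM.vcdRef D (X t)) ^ 2 ≤ 2 * GFM.Wd F D (X t) ∧
        2 * GFM.Wd F D (X t) ≤
          2 * Real.exp (-2 * k * t) * GFM.Wd F D (X 0)
            + D.μd * (1 + N.R ^ 2 + GFM.normLinfty vgd ^ 2) / (k * N.L ^ 2)) ∧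
      (∀ t : ℝ, 0 ≤ t →
        X t .vcq ^ 2 ≤ 2 * GFM.Wq F D (X t) ∧
        2 * GFM.Wq F D (X t) ≤
          2 * Real.exp (-2 * k * t) * GFM.Wq F D (X 0)
            + D.μq * (1 + N.R ^ 2 + GFM.normLinfty vgq ^ 2) / (k * N.L ^ 2)) ∧
      limsup (fun t : ℝ => ((|X t .vcd - GFM.vcdRef D (X t)| : ℝ) : EReal)) atTop
        ≤ ((Real.sqrt (2 * D.ε) : ℝ) : EReal) ∧
      limsup (fun t : ℝ => ((|X t .vcq| : ℝ) : EReal)) atTop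
        ≤ ((Real.sqrt (2 * D.ε) : ℝ) : EReal) := by
  subst hk
  have hk : 0 < min D.KVC D.KCC := lt_min hKVC hKCC
  obtain ⟨X, hX⟩ := GFM.exists_isSolution hωb hCf hLf hL hμd hμq hΓd.le hΓq.le hQbar hPbar
    hvgd hvgq x₀
  have hWd := hX.isAdaptivelyDamped_Wd hωb hCf hLf hL hμd hvgd
  have hWq := hX.isAdaptivelyDamped_Wq hωb hCf hLf hL hμq hvgq
  refine ⟨X, hX, fun Y hY t ht => hY.eq_of_nonneg hX hQbar hPbar ht,
    fun t ht => ⟨GFM.sq_vcd_error_le (X t), ?_⟩, fun t ht => ⟨GFM.sq_vcq_le (X t), ?_⟩,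
    hWd.limsup_abs_le_sqrt hk (by positivity) hΓd hε fun t => GFM.sq_vcd_error_le (X t),
    hWq.limsup_abs_le_sqrt hk (by positivity) hΓq hε fun t => GFM.sq_vcq_le (X t)⟩
  · rw [mul_comm (min _ _) (N.L ^ 2), ← div_div]
    exact hWd.two_mul_energy_le hk (by positivity) ht
  · rw [mul_comm (min _ _) (N.L ^ 2), ← div_div]
    exact hWq.two_mul_energy_le hk (by positivity) ht

theorem theorem2
    (F : GFM.FilterParams) (N : GFM.NetworkParams) (D : GFM.DesignParams)
    (hωb : 0 < F.ωb) (hCf : 0 < F.Cf) (hLf : 0 < F.Lf) (hRf : 0 < F.Rf)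
    (hL : 0 < N.L) (hR : 0 < N.R)
    (hKVC : 0 < D.KVC) (hKCC : 0 < D.KCC) (hμd : 0 < D.μd) (hμq : 0 < D.μq)
    (hΓd : 0 < D.Γd) (hΓq : 0 < D.Γq) (hε : 0 < D.ε)
    (hωpc : 0 < D.ωpc) (hωqc : 0 < D.ωqc) (hξp : 1 < D.ξp) (hξq : 1 < D.ξq)
    (hQbar : 0 < D.Qbar) (hPbar : 0 < D.Pbar)
    (vgd vgq : ℝ → ℝ) (hvgd : GFM.MemLinfty vgd) (hvgq : GFM.MemLinfty vgq)
    (x₀ : GFM.State) (k : ℝ) (hk : k = min D.KVC D.KCC) :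
    ∃ X : ℝ → GFM.State,
      GFM.IsSolution F N D x₀ vgd vgq X ∧
      (∀ Y : ℝ → GFM.State, GFM.IsSolution F N D x₀ vgd vgq Y → ∀ t : ℝ, 0 ≤ t → Y t = X t) ∧
      (∀ t : ℝ, 0 ≤ t →
        (X t .vcd - GFM.vcdRef D (X t)) ^ 2 ≤ 2 * GFM.Wd F D (X t) ∧
        2 * GFM.Wd F D (X t) ≤
          2 * Real.exp (-2 * k * t) * GFM.Wd F D (X 0)
            + D.μd * (1 + N.R ^ 2 + GFM.normLinfty vgd ^ 2) / (k * N.L ^ 2)) ∧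
      (∀ t : ℝ, 0 ≤ t →
        X t .vcq ^ 2 ≤ 2 * GFM.Wq F D (X t) ∧
        2 * GFM.Wq F D (X t) ≤
          2 * Real.exp (-2 * k * t) * GFM.Wq F D (X 0)
            + D.μq * (1 + N.R ^ 2 + GFM.normLinfty vgq ^ 2) / (k * N.L ^ 2)) ∧
      limsup (fun t : ℝ => ((|X t .vcd - GFM.vcdRef D (X t)| : ℝ) : EReal)) atTop
        ≤ ((Real.sqrt (2 * D.ε) : ℝ) : EReal) ∧
      limsup (fun t : ℝ => ((|X t .vcq| : ℝ) : EReal)) atTop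
        ≤ ((Real.sqrt (2 * D.ε) : ℝ) : EReal) :=
  theorem2_general F N D hωb.ne' hCf.ne' hLf.ne' hL.ne' hKVC hKCC hμd hμq hΓd hΓq hε.le hQbar hPbar
    vgd vgq hvgd hvgq x₀ k hk
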